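/- Let $N\ge 1$, let $\mathbb D$ be the open unit ball of $\mathbb R^{N+1}$ with the hyperbolic metric $d$ (Poincaré ball model), $\mathbb S=\partial\mathbb D$ and $\overline{\mathbb D}=\mathbb D\cup\mathbb S$. Let $\mathrm{Con}(N)$ be the group of orientation-preserving isometries of $(\mathbb D,d)$, extended continuously to $\overline{\mathbb D}$. For $g\in\mathrm{Con}(N)$ and $z\in\overline{\mathbb D}$ put $$j(g,z)=\frac{1-|a|^2}{1-2\langle z,a\rangle+|z|^2|a|^2},\qquad a=g^{-1}(0),$$ which is the conformal derivative of $g$ at $z$. **The groups.** Let $\phi:\mathbb N\to[2,\infty)$. Let $C_n^{+},C_n^{-}$ ($n\in\mathbb N$) be open discs in $\mathbb S$ such that, for each $n$, $C_n^+$ and $C_n^-$ have the same (Euclidean, i.e. chordal) radius $r_n\in(0,1)$, and such that the concentric discs $C_n^{\pm,\phi}$ of radii $\phi(n)r_n$ are pairwise disjoint (for all indices $n$ and both signs). Let $g_n\in \mathrm{Con}(N)$ satisfy $g_n(\mathrm{Ext}(C_n^+))=C_n^-$ and $g_n^{-1}(\mathrm{Ext}(C_n^-))=C_n^+$, where $\mathrm{Ext}$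 denotes the exterior in $\mathbb S$, and let $G^{\phi}$ be the group generated by $\{g_n: n\in\mathbb N\}$. **Limit points.** For a subgroup $G$ of $\mathrm{Con}(N)$ let $L(G)=\overline{G(0)}\setminus G(0)$. Let $L_J(G)$ be the set of $\xi\in L(G)$ for which some geodesic ray towards $\xi$ is contained in some Dirichlet fundamental domain $F=\{x\in\mathbb D: d(x,w)<d(x,g(w))\ \forall g\in G\setminus\{1\}\}$ of $G$, where $w\in\mathbb D$ is fixed by no non-trivial element of $G$. Let $L_J'(G^\phi)$ be the set of points of $L_J(G^\phi)$ that lie in $\mathrm{Ext}(C_n^{\pm,\phi})$ for all $n$ and both signs. **Ending measures.** Let $s>0$ be such that $P(z,s)=\sum_{g\in G}j(g,z)^s<\infty$ for all $z\in\mathbb D$, and let $\zeta\in\mathbb S$. An $s$-conformal ending measure of $G$ associated with $\zeta$ is a Borel probability measure on $\overline{\mathbb D}$ that is a weak limit, along a subsequence, of the measures $$\mu_n=\frac1{P(z_n,s)}\sum_{g\in G}j(g,z_n)^s\,\mathbf 1_{g(z_n)},$$ where $\mathbf 1_x$ is the unit point mass at $x$ and $(z_n)$ is a sequence in some Dirichlet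 fundamental domain $F$ of $G$ that tends to $\zeta$ in the Euclidean metric and stays within bounded hyperbolic distance of some geodesic ray towards $\zeta$ contained in $F$. **Proposition.** Let $s>0$ and let $\phi_s:\mathbb N\to[2,\infty)$ be an increasing function with $\sum_{n}(4/\phi_s(n))^{2s}<1/2$. Let $G^{\phi_s}$ be a group as above with $\phi=\phi_s$, and let $\zeta\in L_J'(G^{\phi_s})$. Then the horospherical Poincaré series $\sum_{g\in G^{\phi_s}}j(g,\zeta)^s$ converges. Moreover, $s$-conformal ending measures of $G^{\phi_s}$ associated with $\zeta$ exist, and every such measure $\mu$ is $s$-conformal, i.e. $\mu(g(A))=\int_A j(g,z)^s\,d\mu(z)$ for all $g\in G^{\phi_s}$ and all measurable $A\subseteq\overline{\mathbb D}$, is purely atomic, and has essential support equal to the orbit $G^{\phi_s}(\zeta)$: $\mu(\overline{\mathbb D}\setminus G^{\phi_s}(\zeta))=0$ and $\mu(\{x\})>0$ for every $x\in G^{\phi_s}(\zeta)$. -/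

import Mathlib

/-- The Euclidean space of dimension `N + 1`. -/
abbrev Euc (N : ℕ) : Type := EuclideanSpace ℝ (Fin (N + 1))

/-- The closed unit ball, i.e. hyperbolic space together with its boundary sphere. -/
abbrev ClosedUnitBall (N : ℕ) : Type := Metric.closedBall (0 : Euc N) 1

/-- The open unit ball: the Poincaré ball model of `(N + 1)`-dimensional hyperbolic space. -/
def hypBall (N : ℕ) : Set (ClosedUnitBall N) := {x | ‖(x : Euc N)‖ < 1}

/-- The boundary sphere of dimension `N`. -/
def bdSphere (N : ℕ) : Set (ClosedUnitBall N) := {x | ‖(x : Euc N)‖ = 1}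

/-- The origin of the ball model. -/
def origin (N : ℕ) : ClosedUnitBall N := ⟨0, by simp⟩

/-- The hyperbolic distance (curvature `-1`) of the Poincaré ball model, meaningful for points of
the open ball: `sinh² (d / 2) = |x - y|² / ((1 - |x|²) (1 - |y|²))`. -/
noncomputable def hypDist {N : ℕ} (x y : ClosedUnitBall N) : ℝ :=
  2 * Real.arsinh (‖(x : Euc N) - (y : Euc N)‖ /
    Real.sqrt ((1 - ‖(x : Euc N)‖ ^ 2) * (1 - ‖(y : Euc N)‖ ^ 2)))

open Classical in
/-- A self-map of the closed ball, viewed as a map on the ambient Euclidean space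
(only its germs at points of the open ball are used). -/
noncomputable def ambient {N : ℕ} (g : ClosedUnitBall N ≃ₜ ClosedUnitBall N) (x : Euc N) : Euc N :=
  if h : x ∈ Metric.closedBall (0 : Euc N) 1 then (g ⟨x, h⟩ : Euc N) else x

theorem ambient_coe {N : ℕ} (g : ClosedUnitBall N ≃ₜ ClosedUnitBall N) (x : ClosedUnitBall N) :
    ambient g (x : Euc N) = (g x : Euc N) := by
  have h : (x : Euc N) ∈ Metric.closedBall (0 : Euc N) 1 := x.2
  simp only [ambient, dif_pos h]

theorem hypBall_mem_nhds {N : ℕ} {x : ClosedUnitBall N} (hx : x ∈ hypBall N) :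
    Metric.closedBall (0 : Euc N) 1 ∈ nhds (x : Euc N) := by
  apply Metric.closedBall_mem_nhds_of_mem
  simpa [hypBall] using hx

theorem ambient_differentiableAt {N : ℕ} {g : ClosedUnitBall N ≃ₜ ClosedUnitBall N} {x : Euc N}
    (h : 0 < (fderiv ℝ (ambient g) x).det) : DifferentiableAt ℝ (ambient g) x := by
  by_contra hd
  rw [fderiv_zero_of_not_differentiableAt hd] at h
  simp [ContinuousLinearMap.det] at h

/-- The group of orientation-preserving hyperbolic isometries of the ball model, each of
them together with its continuous extension to the boundary sphere (on which it acts as a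
conformal automorphism). -/
noncomputable def confGroup (N : ℕ) : Subgroup (ClosedUnitBall N ≃ₜ ClosedUnitBall N) where
  carrier := {g | (∀ x, g x ∈ hypBall N ↔ x ∈ hypBall N) ∧
    (∀ x ∈ hypBall N, ∀ y ∈ hypBall N, hypDist (g x) (g y) = hypDist x y) ∧
    (∀ x ∈ hypBall N, 0 < (fderiv ℝ (ambient g) (x : Euc N)).det)}
  one_mem' := by
    refine ⟨fun x => Iff.rfl, fun x _ y _ => rfl, fun x _ => ?_⟩
    have h : ambient (1 : ClosedUnitBall N ≃ₜ ClosedUnitBall N) = id := by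
      funext y
      unfold ambient
      split_ifs <;> rfl
    rw [h, fderiv_id]
    simp [ContinuousLinearMap.det]
  mul_mem' := by
    rintro g h ⟨hg1, hg2, hg3⟩ ⟨hh1, hh2, hh3⟩
    refine ⟨fun x => (hg1 _).trans (hh1 x),
      fun x hx y hy => (hg2 _ ((hh1 x).2 hx) _ ((hh1 y).2 hy)).trans (hh2 x hx y hy),
      fun x hx => ?_⟩
    have e : ambient (g * h) =ᶠ[nhds (x : Euc N)] ambient g ∘ ambient h := by
      filter_upwards [hypBall_mem_nhds hx] with y hy
      have h1 := ambient_coe (g * h) ⟨y, hy⟩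
      have h2 := ambient_coe h ⟨y, hy⟩
      have h3 := ambient_coe g (h ⟨y, hy⟩)
      simp only at h1 h2
      rw [Function.comp_apply, h1, h2, h3]
      rfl
    have dh := hh3 x hx
    have dg := hg3 (h x) ((hh1 x).2 hx)
    rw [← ambient_coe h x] at dg
    rw [e.fderiv_eq, fderiv_comp _ (ambient_differentiableAt dg) (ambient_differentiableAt dh)]
    simp only [ContinuousLinearMap.det, ContinuousLinearMap.toLinearMap_comp, LinearMap.det_comp]
      at dg dh ⊢
    exact mul_pos dg dh
  inv_mem' := by
    rintro g ⟨hg1, hg2, hg3⟩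
    have gi : ∀ x, g (g⁻¹ x) = x := fun x => g.apply_symm_apply x
    have k1 : ∀ x, g⁻¹ x ∈ hypBall N ↔ x ∈ hypBall N := fun x => by
      rw [← hg1, gi]
    refine ⟨k1, fun x hx y hy => ?_, fun x hx => ?_⟩
    · rw [← hg2 _ ((k1 x).2 hx) _ ((k1 y).2 hy), gi, gi]
    · have dg := hg3 (g⁻¹ x) ((k1 x).2 hx)
      have hd := (ambient_differentiableAt dg).hasFDerivAt
      rw [← ambient_coe g⁻¹ x] at dg hd
      set A := fderiv ℝ (ambient g) (ambient g⁻¹ (x : Euc N)) with hA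
      let e : Euc N ≃L[ℝ] Euc N := ContinuousLinearMap.toContinuousLinearEquivOfDetNeZero A dg.ne'
      have he : (e : Euc N →L[ℝ] Euc N) = A := by
        ext v
        simp [e]
      have hc : ContinuousAt (ambient g⁻¹) (x : Euc N) := by
        have c1 : ContinuousOn (ambient g⁻¹) (Metric.closedBall (0 : Euc N) 1) := by
          rw [continuousOn_iff_continuous_domRestrict]
          have : (Metric.closedBall (0 : Euc N) 1).domRestrict (ambient g⁻¹)
              = fun y => ((g⁻¹ y : ClosedUnitBall N) : Euc N) := by
            funext y
            exact ambient_coe g⁻¹ y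
          rw [this]
          exact continuous_subtype_val.comp (g⁻¹).continuous
        exact c1.continuousAt (hypBall_mem_nhds hx)
      have hi : ∀ᶠ y in nhds (x : Euc N), ambient g (ambient g⁻¹ y) = y := by
        filter_upwards [hypBall_mem_nhds hx] with y hy
        have h2 := ambient_coe g⁻¹ ⟨y, hy⟩
        simp only at h2
        rw [h2, ambient_coe, gi]
      rw [← he] at hd
      have hinv := HasFDerivAt.of_local_left_inverse hc hd hi
      rw [hinv.fderiv]
      have hmul : ((e.symm : Euc N →L[ℝ] Euc N)).det * A.det = 1 := by
        rw [← he]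
        have : ((e.symm : Euc N →L[ℝ] Euc N)) ∘L (e : Euc N →L[ℝ] Euc N)
            = ContinuousLinearMap.id ℝ (Euc N) := by
          ext v
          simp
        have h4 := congrArg ContinuousLinearMap.det this
        have h5 : (ContinuousLinearMap.id ℝ (Euc N)).det = 1 := by
          simp [ContinuousLinearMap.det]
        rw [h5] at h4
        simpa only [ContinuousLinearMap.det, ContinuousLinearMap.toLinearMap_comp,
          LinearMap.det_comp] using h4
      have : 0 < ((e.symm : Euc N →L[ℝ] Euc N)).det * A.det := by
        rw [hmul]
        exact one_pos
      exact pos_of_mul_pos_left this dg.le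

/-- The conformal derivative `j (g, z) = (1 - |a|²) / (|z* - a|² |z|²)` with `a = g⁻¹ (0)` and
`z*` the reflection of `z` in the unit sphere. The denominator is written out as
`1 - 2 ⟪z, a⟫ + |z|² |a|²`, so that the formula also covers `z = 0`; for `|z| = 1` it is
`|z - a|²`. -/
noncomputable def confDeriv {N : ℕ} (g : ClosedUnitBall N ≃ₜ ClosedUnitBall N)
    (z : ClosedUnitBall N) : ℝ :=
  (1 - ‖(g⁻¹ (origin N) : Euc N)‖ ^ 2) /
    (1 - 2 * inner ℝ (z : Euc N) (g⁻¹ (origin N) : Euc N)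
      + ‖(z : Euc N)‖ ^ 2 * ‖(g⁻¹ (origin N) : Euc N)‖ ^ 2)

/-- The orbit `G (z)`. -/
def groupOrbit {N : ℕ} (G : Subgroup (ClosedUnitBall N ≃ₜ ClosedUnitBall N))
    (z : ClosedUnitBall N) : Set (ClosedUnitBall N) :=
  {x | ∃ g ∈ G, g z = x}

/-- The limit set: the accumulation set `closure (G (0)) \ G (0)` of the orbit of the origin. -/
def limitSet {N : ℕ} (G : Subgroup (ClosedUnitBall N ≃ₜ ClosedUnitBall N)) :
    Set (ClosedUnitBall N) :=
  closure (groupOrbit G (origin N)) \ groupOrbit G (origin N)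

/-- `w` is an admissible centre of a Dirichlet fundamental domain of `G`: a point of the open ball
fixed by no non-trivial element of `G`. -/
def IsDirichletCentre {N : ℕ} (G : Subgroup (ClosedUnitBall N ≃ₜ ClosedUnitBall N))
    (w : ClosedUnitBall N) : Prop :=
  w ∈ hypBall N ∧ ∀ g ∈ G, g w = w → g = 1

/-- The Dirichlet fundamental domain of `G` with centre `w`. -/
def dirichletDomain {N : ℕ} (G : Subgroup (ClosedUnitBall N ≃ₜ ClosedUnitBall N))
    (w : ClosedUnitBall N) : Set (ClosedUnitBall N) :=
  {x | x ∈ hypBall N ∧ ∀ g ∈ G, g ≠ 1 → hypDist x w < hypDist x (g w)}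

/-- `γ`, restricted to `[0, ∞)`, is a hyperbolic geodesic ray (parametrised by arc length)
towards the boundary point `ζ`. -/
def IsGeodesicRay {N : ℕ} (γ : ℝ → ClosedUnitBall N) (ζ : ClosedUnitBall N) : Prop :=
  (∀ t, 0 ≤ t → γ t ∈ hypBall N) ∧
  (∀ t u, 0 ≤ t → 0 ≤ u → hypDist (γ t) (γ u) = |t - u|) ∧
  ζ ∈ bdSphere N ∧ Filter.Tendsto γ Filter.atTop (nhds ζ)

/-- The set of Jørgensen limit points: limit points towards which there is a geodesic ray that is
fully contained in some Dirichlet fundamental domain. -/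
def jorgensenSet {N : ℕ} (G : Subgroup (ClosedUnitBall N ≃ₜ ClosedUnitBall N)) :
    Set (ClosedUnitBall N) :=
  {ξ | ξ ∈ limitSet G ∧ ∃ w, IsDirichletCentre G w ∧ ∃ γ, IsGeodesicRay γ ξ ∧
    ∀ t, 0 ≤ t → γ t ∈ dirichletDomain G w}

/-- `z` is an ending sequence tending to `ζ` inside the Dirichlet fundamental domain of `G` with
centre `w`: all `z n` lie in the domain, within bounded hyperbolic distance of a geodesic ray
towards `ζ` contained in the domain, and `z n` tends to `ζ` in the Euclidean metric. -/
def IsEndingSequence {N : ℕ} (G : Subgroup (ClosedUnitBall N ≃ₜ ClosedUnitBall N))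
    (w ζ : ClosedUnitBall N) (z : ℕ → ClosedUnitBall N) : Prop :=
  (∀ n, z n ∈ dirichletDomain G w) ∧
  (∃ γ, IsGeodesicRay γ ζ ∧ (∀ t, 0 ≤ t → γ t ∈ dirichletDomain G w) ∧
    ∃ C : ℝ, ∀ n, ∃ t, 0 ≤ t ∧ hypDist (z n) (γ t) ≤ C) ∧
  Filter.Tendsto z Filter.atTop (nhds ζ)

/-- The series `∑ j (g, z) ^ s` over `g ∈ G` converges: for `z` in the open ball this is the
Poincaré series, for `z` on the boundary sphere the horospherical Poincaré series. -/
def PoincareConverges {N : ℕ} (G : Subgroup (ClosedUnitBall N ≃ₜ ClosedUnitBall N))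
    (z : ClosedUnitBall N) (s : ℝ) : Prop :=
  Summable fun g : G => confDeriv (g : ClosedUnitBall N ≃ₜ ClosedUnitBall N) z ^ s

/-- The normalised orbit measure
`(∑ j (g, z) ^ s)⁻¹ ∑ j (g, z) ^ s • δ_{g (z)}`, both sums over `g ∈ G`. -/
noncomputable def orbitMeasure {N : ℕ} (G : Subgroup (ClosedUnitBall N ≃ₜ ClosedUnitBall N))
    (s : ℝ) (z : ClosedUnitBall N) : MeasureTheory.Measure (ClosedUnitBall N) :=
  (∑' g : G, ENNReal.ofReal (confDeriv (g : ClosedUnitBall N ≃ₜ ClosedUnitBall N) z ^ s))⁻¹ •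
    MeasureTheory.Measure.sum fun g : G =>
      ENNReal.ofReal (confDeriv (g : ClosedUnitBall N ≃ₜ ClosedUnitBall N) z ^ s) •
        MeasureTheory.Measure.dirac ((g : ClosedUnitBall N ≃ₜ ClosedUnitBall N) z)

/-- `μ` is an ending measure of exponent `s` for `G` associated to `ζ`: the Poincaré series of `G`
converges at `s`, and `μ` is a probability measure on the closed ball that is the weak limit, along
a subsequence, of the normalised orbit measures of some ending sequence tending to `ζ`. -/
def IsEndingMeasure {N : ℕ} (G : Subgroup (ClosedUnitBall N ≃ₜ ClosedUnitBall N)) (s : ℝ)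
    (ζ : ClosedUnitBall N) (μ : MeasureTheory.Measure (ClosedUnitBall N)) : Prop :=
  (∀ z ∈ hypBall N, PoincareConverges G z s) ∧ MeasureTheory.IsProbabilityMeasure μ ∧
  ∃ w z, IsDirichletCentre G w ∧ IsEndingSequence G w ζ z ∧
    ∃ k : ℕ → ℕ, StrictMono k ∧ ∀ f : C(ClosedUnitBall N, ℝ),
      Filter.Tendsto (fun n => ∫ x, f x ∂(orbitMeasure G s (z (k n)))) Filter.atTop
        (nhds (∫ x, f x ∂μ))

/-- The probability measure `μ` on the closed ball is `s`-conformal for `G`. -/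
def IsConformalMeasure {N : ℕ} (G : Subgroup (ClosedUnitBall N ≃ₜ ClosedUnitBall N)) (s : ℝ)
    (μ : MeasureTheory.Measure (ClosedUnitBall N)) : Prop :=
  MeasureTheory.IsProbabilityMeasure μ ∧
  ∀ g ∈ G, ∀ A : Set (ClosedUnitBall N), MeasurableSet A →
    μ (g '' A) = ∫⁻ z in A, ENNReal.ofReal (confDeriv g z ^ s) ∂μ

/-- Every measurable set of positive measure contains a point of positive mass. -/
def IsPurelyAtomic {X : Type*} [MeasurableSpace X] (μ : MeasureTheory.Measure X) : Prop :=
  ∀ A : Set X, MeasurableSet A → 0 < μ A → ∃ x ∈ A, 0 < μ {x}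

/-- The open disc in the boundary sphere with centre `c` and radius `r`, measured in the Euclidean
(chordal) metric. -/
def bdDisc {N : ℕ} (c : ClosedUnitBall N) (r : ℝ) : Set (ClosedUnitBall N) :=
  {x | x ∈ bdSphere N ∧ dist x c < r}

/-- The exterior, in the boundary sphere, of the disc with centre `c` and radius `r`, i.e. the
complement of the closed disc. -/
def bdExt {N : ℕ} (c : ClosedUnitBall N) (r : ℝ) : Set (ClosedUnitBall N) :=
  {x | x ∈ bdSphere N ∧ r < dist x c}

/-- The data defining an infinitely generated classical Schottky group with enlargement
function `φ`: discs `C n ε` (`ε = true` stands for `+` and `ε = false` for `-`) in the boundary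
sphere, with radii `r n < 1` and such that the concentric discs of radii `φ n * r n` are pairwise
disjoint, and, for each `n`, a transformation `g n` mapping the exterior of `C n +` onto `C n -`
and whose inverse maps the exterior of `C n -` onto `C n +`. -/
structure SchottkyData (N : ℕ) (φ : ℕ → ℝ) where
  centre : ℕ → Bool → ClosedUnitBall N
  centre_mem : ∀ n ε, centre n ε ∈ bdSphere N
  radius : ℕ → ℝ
  radius_pos : ∀ n, 0 < radius n
  radius_lt_one : ∀ n, radius n < 1
  disjoint_enlarged : ∀ n m : ℕ, ∀ ε ε' : Bool, (n, ε) ≠ (m, ε') →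
    Disjoint (bdDisc (centre n ε) (φ n * radius n)) (bdDisc (centre m ε') (φ m * radius m))
  gen : ℕ → ClosedUnitBall N ≃ₜ ClosedUnitBall N
  gen_mem : ∀ n, gen n ∈ confGroup N
  gen_image : ∀ n, gen n '' bdExt (centre n true) (radius n) = bdDisc (centre n false) (radius n)
  gen_inv_image : ∀ n,
    (gen n).symm '' bdExt (centre n false) (radius n) = bdDisc (centre n true) (radius n)

/-- The infinitely generated Schottky group `G^φ`. -/
def SchottkyData.group {N : ℕ} {φ : ℕ → ℝ} (S : SchottkyData N φ) :
    Subgroup (ClosedUnitBall N ≃ₜ ClosedUnitBall N) :=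
  Subgroup.closure (Set.range S.gen)

theorem SchottkyData.group_le {N : ℕ} {φ : ℕ → ℝ} (S : SchottkyData N φ) : S.group ≤ confGroup N := by
  rw [SchottkyData.group, Subgroup.closure_le]
  rintro _ ⟨n, rfl⟩
  exact S.gen_mem n

/-- The set `L_J'` of those Jørgensen limit points which lie in the exterior of every enlarged
disc. -/
def SchottkyData.jorgensenSet' {N : ℕ} {φ : ℕ → ℝ} (S : SchottkyData N φ) :
    Set (ClosedUnitBall N) :=
  jorgensenSet S.group ∩ ⋂ (n : ℕ) (ε : Bool), bdExt (S.centre n ε) (φ n * S.radius n)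

/-!
A Möbius map satisfies `|g x - g y|² = j(g, x) j(g, y) |x - y|²`, so it preserves cross ratios up to
the derivative: `j(g, x) |x - y| |x - z| |g y - g z| = |g x - g y| |g x - g z| |y - z|`. If `g` maps
the exterior of a disc of radius `r` onto the inside of another one of the same radius, choose `y`
and `z` on the first boundary circle so that `g y` and `g z` realise the diameter of the second.
Then `|y - z| ≤ |g y - g z|`, and `j(g, x) ≤ (2 / (q - 1))²` for every `x` at distance at least
`q r` from the centre. A reduced word maps a point outside all enlarged discs through such positions
only (ping-pong), so by the chain rule the series over the group is dominated by the sum over all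
words of the products of these bounds, a geometric series.

For the ending measures let `z` run through an ending sequence towards `ζ`. Geodesic rays, and
hence ending sequences, stay in a Stolz region at `ζ`, while the inequality
`d(z, w) ≤ d(g z, w)` on the Dirichlet domain bounds `j(g, z)` uniformly in `g`. Together these give
`j(g, z) ≤ M j(g, ζ)` with `M` independent of `g`. By dominated convergence the orbit measures of
the ending sequence converge to the orbit measure of `ζ` itself, which is therefore the only ending
measure.
-/

open Filter Topology MeasureTheory
open scoped ENNReal

section ConformalDenominator

variable {E : Type*} [NormedAddCommGroup E] [InnerProductSpace ℝ E] {z a : E}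

/-- The denominator `1 - 2⟪z, a⟫ + |z|²|a|²` of the conformal derivative at `z` of a transformation
that sends `a` to the origin. -/
noncomputable def confDenom (z a : E) : ℝ := 1 - 2 * inner ℝ z a + ‖z‖ ^ 2 * ‖a‖ ^ 2

theorem confDenom_eq (z a : E) :
    confDenom z a = ‖z - a‖ ^ 2 + (1 - ‖z‖ ^ 2) * (1 - ‖a‖ ^ 2) := by
  rw [confDenom, norm_sub_sq_real]
  ring

theorem sq_one_sub_mul_le_confDenom (z a : E) : (1 - ‖z‖ * ‖a‖) ^ 2 ≤ confDenom z a := by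
  have cauchy_schwarz := real_inner_le_norm z a
  rw [confDenom]
  nlinarith

theorem confDenom_le_sq_one_add_mul (z a : E) : confDenom z a ≤ (1 + ‖z‖ * ‖a‖) ^ 2 := by
  have cauchy_schwarz := neg_le_of_abs_le (abs_real_inner_le_norm z a)
  rw [confDenom]
  nlinarith

theorem confDenom_pos (hz : ‖z‖ ≤ 1) (ha : ‖a‖ < 1) : 0 < confDenom z a := by
  have : ‖z‖ * ‖a‖ < 1 := mul_lt_one_of_nonneg_of_lt_one_right hz (norm_nonneg a) ha
  exact (pow_pos (sub_pos.2 this) 2).trans_le (sq_one_sub_mul_le_confDenom z a)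

theorem confDenom_le_four (hz : ‖z‖ ≤ 1) (ha : ‖a‖ ≤ 1) : confDenom z a ≤ 4 := by
  have : ‖z‖ * ‖a‖ ≤ 1 := mul_le_one₀ hz (norm_nonneg a) ha
  have : 0 ≤ ‖z‖ * ‖a‖ := by positivity
  nlinarith [confDenom_le_sq_one_add_mul z a]

end ConformalDenominator

section HyperbolicDistance

variable {N : ℕ} {x y : ClosedUnitBall N}

theorem norm_coe_le_one (x : ClosedUnitBall N) : ‖(x : Euc N)‖ ≤ 1 :=
  mem_closedBall_zero_iff.1 x.2

theorem dist_le_two (x y : ClosedUnitBall N) : dist x y ≤ 2 := by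
  rw [Subtype.dist_eq, dist_eq_norm]
  linarith [norm_sub_le (x : Euc N) y, norm_coe_le_one x, norm_coe_le_one y]

theorem coe_origin : (origin N : Euc N) = 0 := rfl

theorem origin_mem_hypBall : origin N ∈ hypBall N := by
  simp [hypBall, coe_origin]

theorem notMem_hypBall_iff : x ∉ hypBall N ↔ x ∈ bdSphere N :=
  not_lt.trans ⟨(norm_coe_le_one x).antisymm, ge_of_eq⟩

theorem one_sub_norm_sq_pos (hx : x ∈ hypBall N) : 0 < 1 - ‖(x : Euc N)‖ ^ 2 :=
  sub_pos.2 (pow_lt_one₀ (norm_nonneg _) hx two_ne_zero)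

theorem one_sub_norm_sq_nonneg (x : ClosedUnitBall N) : 0 ≤ 1 - ‖(x : Euc N)‖ ^ 2 :=
  sub_nonneg.2 (pow_le_one₀ (norm_nonneg _) (norm_coe_le_one x))

theorem dense_hypBall (N : ℕ) : Dense (hypBall N) := by
  have coe_image : Subtype.val '' hypBall N = Metric.ball (0 : Euc N) 1 := by
    ext y
    simp only [hypBall, Set.mem_image, Set.mem_ofPred_eq, mem_ball_zero_iff]
    exact ⟨fun ⟨_, hx, hxy⟩ => hxy ▸ hx,
      fun hy => ⟨⟨y, mem_closedBall_zero_iff.2 hy.le⟩, hy, rfl⟩⟩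
  rw [Subtype.dense_iff, coe_image, closure_ball _ one_ne_zero]

theorem hypDist_nonneg (x y : ClosedUnitBall N) : 0 ≤ hypDist x y :=
  mul_nonneg zero_le_two (Real.arsinh_nonneg_iff.2 (by positivity))

theorem sinh_half_hypDist_sq (hx : x ∈ hypBall N) (hy : y ∈ hypBall N) :
    Real.sinh (hypDist x y / 2) ^ 2 =
      dist x y ^ 2 / ((1 - ‖(x : Euc N)‖ ^ 2) * (1 - ‖(y : Euc N)‖ ^ 2)) := by
  rw [hypDist, mul_div_cancel_left₀ _ two_ne_zero, Real.sinh_arsinh, div_pow, Real.sq_sqrt,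
    Subtype.dist_eq, dist_eq_norm]
  exact (mul_pos (one_sub_norm_sq_pos hx) (one_sub_norm_sq_pos hy)).le

theorem dist_sq_eq_sinh_half_hypDist_sq_mul (hx : x ∈ hypBall N) (hy : y ∈ hypBall N) :
    dist x y ^ 2 =
      Real.sinh (hypDist x y / 2) ^ 2 * ((1 - ‖(x : Euc N)‖ ^ 2) * (1 - ‖(y : Euc N)‖ ^ 2)) := by
  have hxy := mul_pos (one_sub_norm_sq_pos hx) (one_sub_norm_sq_pos hy)
  rw [sinh_half_hypDist_sq hx hy, div_mul_cancel₀ _ hxy.ne']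

end HyperbolicDistance

section ConformalDerivative

variable {N : ℕ} {g h : ClosedUnitBall N ≃ₜ ClosedUnitBall N} {x y z : ClosedUnitBall N}

theorem map_mem_hypBall_iff (hg : g ∈ confGroup N) : g x ∈ hypBall N ↔ x ∈ hypBall N := hg.1 x

theorem map_mem_bdSphere_iff (hg : g ∈ confGroup N) : g x ∈ bdSphere N ↔ x ∈ bdSphere N := by
  rw [← notMem_hypBall_iff, ← notMem_hypBall_iff, map_mem_hypBall_iff hg]

theorem hypDist_map_map (hg : g ∈ confGroup N) (hx : x ∈ hypBall N) (hy : y ∈ hypBall N) :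
    hypDist (g x) (g y) = hypDist x y :=
  hg.2.1 x hx y hy

theorem inv_origin_mem_hypBall (hg : g ∈ confGroup N) : g⁻¹ (origin N) ∈ hypBall N :=
  (map_mem_hypBall_iff (inv_mem hg)).2 origin_mem_hypBall

theorem confDeriv_eq (g : ClosedUnitBall N ≃ₜ ClosedUnitBall N) (z : ClosedUnitBall N) :
    confDeriv g z = (1 - ‖(g⁻¹ (origin N) : Euc N)‖ ^ 2) /
      confDenom (z : Euc N) (g⁻¹ (origin N) : Euc N) := rfl

theorem confDenom_inv_origin_pos (hg : g ∈ confGroup N) (z : ClosedUnitBall N) :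
    0 < confDenom (z : Euc N) (g⁻¹ (origin N) : Euc N) :=
  confDenom_pos (norm_coe_le_one z) (inv_origin_mem_hypBall hg)

theorem confDeriv_pos (hg : g ∈ confGroup N) (z : ClosedUnitBall N) : 0 < confDeriv g z :=
  div_pos (one_sub_norm_sq_pos (inv_origin_mem_hypBall hg)) (confDenom_inv_origin_pos hg z)

theorem continuous_confDeriv (hg : g ∈ confGroup N) : Continuous (confDeriv g) :=
  Continuous.div (by fun_prop) (by fun_prop) fun z => (confDenom_inv_origin_pos hg z).ne'

theorem confDeriv_one (z : ClosedUnitBall N) : confDeriv 1 z = 1 := by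
  simp [confDeriv, coe_origin]

theorem one_sub_norm_sq_map (hg : g ∈ confGroup N) (hx : x ∈ hypBall N) :
    1 - ‖(g x : Euc N)‖ ^ 2 = confDeriv g x * (1 - ‖(x : Euc N)‖ ^ 2) := by
  have ha := inv_origin_mem_hypBall hg
  have hgx := (map_mem_hypBall_iff hg).2 hx
  have hgx_pos := one_sub_norm_sq_pos hgx
  have hx_pos := one_sub_norm_sq_pos hx
  have ha_pos := one_sub_norm_sq_pos ha
  have isometry : hypDist (g x) (origin N) = hypDist x (g⁻¹ (origin N)) :=
    (congrArg _ (g.apply_symm_apply _).symm).trans (hypDist_map_map hg hx ha)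
  have sinh_eq := congrArg (fun d => Real.sinh (d / 2) ^ 2) isometry
  simp only [sinh_half_hypDist_sq hgx origin_mem_hypBall, sinh_half_hypDist_sq hx ha,
    Subtype.dist_eq, dist_eq_norm, coe_origin, sub_zero, norm_zero] at sinh_eq
  rw [div_eq_div_iff (by positivity) (by positivity)] at sinh_eq
  rw [confDeriv_eq, div_mul_eq_mul_div, eq_div_iff (confDenom_inv_origin_pos hg x).ne',
    confDenom_eq]
  linear_combination -sinh_eq

theorem dist_map_map_sq (hg : g ∈ confGroup N) (x y : ClosedUnitBall N) :
    dist (g x) (g y) ^ 2 = confDeriv g x * confDeriv g y * dist x y ^ 2 := by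
  have hg_cont : Continuous g := g.continuous
  have hderiv_cont := continuous_confDeriv hg
  suffices (fun q : ClosedUnitBall N × ClosedUnitBall N => dist (g q.1) (g q.2) ^ 2) =
      fun q => confDeriv g q.1 * confDeriv g q.2 * dist q.1 q.2 ^ 2 from congrFun this (x, y)
  refine Continuous.ext_on ((dense_hypBall N).prod (dense_hypBall N)) (by fun_prop) (by fun_prop) ?_
  rintro ⟨x, y⟩ ⟨hx, hy⟩
  dsimp only at hx hy ⊢
  rw [dist_sq_eq_sinh_half_hypDist_sq_mul ((map_mem_hypBall_iff hg).2 hx)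
    ((map_mem_hypBall_iff hg).2 hy), dist_sq_eq_sinh_half_hypDist_sq_mul hx hy,
    hypDist_map_map hg hx hy, one_sub_norm_sq_map hg hx, one_sub_norm_sq_map hg hy]
  ring

theorem confDeriv_mul (hg : g ∈ confGroup N) (hh : h ∈ confGroup N) (z : ClosedUnitBall N) :
    confDeriv (g * h) z = confDeriv g (h z) * confDeriv h z := by
  refine congrFun (Continuous.ext_on (dense_hypBall N) (continuous_confDeriv (mul_mem hg hh))
    (((continuous_confDeriv hg).comp h.continuous).mul (continuous_confDeriv hh)) ?_) z
  intro x hx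
  refine mul_right_cancel₀ (one_sub_norm_sq_pos hx).ne' ?_
  calc confDeriv (g * h) x * (1 - ‖(x : Euc N)‖ ^ 2)
      = 1 - ‖(g (h x) : Euc N)‖ ^ 2 := (one_sub_norm_sq_map (mul_mem hg hh) hx).symm
    _ = confDeriv g (h x) * (confDeriv h x * (1 - ‖(x : Euc N)‖ ^ 2)) := by
        rw [one_sub_norm_sq_map hg ((map_mem_hypBall_iff hh).2 hx), one_sub_norm_sq_map hh hx]
    _ = confDeriv g (h x) * confDeriv h x * (1 - ‖(x : Euc N)‖ ^ 2) := (mul_assoc _ _ _).symm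

theorem confDeriv_mul_dist_mul_dist_mul_dist_map (hg : g ∈ confGroup N)
    (x y z : ClosedUnitBall N) :
    confDeriv g x * (dist x y * dist x z * dist (g y) (g z)) =
      dist (g x) (g y) * dist (g x) (g z) * dist y z := by
  have hx := confDeriv_pos hg x
  refine (pow_left_inj₀ (by positivity) (by positivity) two_ne_zero).1 ?_
  simp only [mul_pow, dist_map_map_sq hg]
  ring

end ConformalDerivative

section SphericalCircle

variable {E : Type*} [NormedAddCommGroup E] [InnerProductSpace ℝ E] {c y z : E} {r : ℝ}

theorem norm_sub_eq_iff_inner_eq (hc : ‖c‖ = 1) (hy : ‖y‖ = 1) (hr : 0 ≤ r) :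
    ‖y - c‖ = r ↔ inner ℝ y c = 1 - r ^ 2 / 2 := by
  rw [← pow_left_inj₀ (norm_nonneg _) hr two_ne_zero, norm_sub_sq_real, hc, hy]
  constructor <;> intro h <;> linarith

theorem norm_sub_sq_le_of_norm_sub_eq (hc : ‖c‖ = 1) (hy : ‖y‖ = 1) (hz : ‖z‖ = 1)
    (hyr : ‖y - c‖ = r) (hzr : ‖z - c‖ = r) : ‖y - z‖ ^ 2 ≤ r ^ 2 * (4 - r ^ 2) := by
  have hr : 0 ≤ r := hyr ▸ norm_nonneg _
  have inner_sum : inner ℝ (y + z) c = 2 - r ^ 2 := by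
    rw [inner_add_left, (norm_sub_eq_iff_inner_eq hc hy hr).1 hyr,
      (norm_sub_eq_iff_inner_eq hc hz hr).1 hzr]
    ring
  have norm_sum_ge : (2 - r ^ 2) ^ 2 ≤ ‖y + z‖ ^ 2 := by
    have cauchy_schwarz := abs_real_inner_le_norm (y + z) c
    rw [inner_sum, hc, mul_one] at cauchy_schwarz
    exact sq_le_sq' (abs_le.1 cauchy_schwarz).1 (abs_le.1 cauchy_schwarz).2
  have parallelogram := parallelogram_law_with_norm ℝ y z
  rw [hy, hz] at parallelogram
  linarith

theorem exists_norm_eq_one_inner_eq_zero (hE : 1 < Module.rank ℝ E) (c : E) :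
    ∃ u : E, ‖u‖ = 1 ∧ inner ℝ c u = 0 := by
  have span_ne_top : Submodule.span ℝ {c} ≠ ⊤ := fun span_eq => by
    have rank_le := rank_span_le (R := ℝ) {c}
    rw [span_eq, rank_top, Cardinal.mk_singleton] at rank_le
    exact hE.not_ge rank_le
  obtain ⟨v, hv, hv0⟩ := Submodule.exists_mem_ne_zero_of_ne_bot
    (mt Submodule.orthogonal_eq_bot_iff.1 span_ne_top)
  refine ⟨(‖v‖⁻¹ : ℝ) • v, norm_smul_inv_norm hv0, ?_⟩
  rw [inner_smul_right, Submodule.mem_orthogonal_singleton_iff_inner_right.1 hv, mul_zero]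

theorem exists_norm_sub_sq_eq_of_norm_sub_eq (hE : 1 < Module.rank ℝ E) (hc : ‖c‖ = 1)
    (hr : 0 ≤ r) (hr_two : r ≤ 2) :
    ∃ y z : E, ‖y‖ = 1 ∧ ‖z‖ = 1 ∧ ‖y - c‖ = r ∧ ‖z - c‖ = r ∧
      ‖y - z‖ ^ 2 = r ^ 2 * (4 - r ^ 2) := by
  obtain ⟨u, hu, huc⟩ := exists_norm_eq_one_inner_eq_zero hE c
  have huc' : inner ℝ u c = 0 := by rw [real_inner_comm, huc]
  set t := √(r ^ 2 * (4 - r ^ 2))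
  have ht_sq : t ^ 2 = r ^ 2 * (4 - r ^ 2) := Real.sq_sqrt (mul_nonneg (sq_nonneg r) (by nlinarith))
  have norm_point {τ : ℝ} (hτ : τ ^ 2 = t ^ 2) : ‖(1 - r ^ 2 / 2) • c + (τ / 2) • u‖ = 1 := by
    refine (pow_left_inj₀ (norm_nonneg _) zero_le_one two_ne_zero).1 ?_
    rw [norm_add_sq_real, inner_smul_left, inner_smul_right, huc, norm_smul, norm_smul, hc, hu]
    simp only [Real.norm_eq_abs, mul_one, mul_zero, add_zero, sq_abs]
    linear_combination (1 / 4) * hτ + (1 / 4) * ht_sq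
  have norm_point_sub {τ : ℝ} (hτ : τ ^ 2 = t ^ 2) :
      ‖(1 - r ^ 2 / 2) • c + (τ / 2) • u - c‖ = r := by
    rw [norm_sub_eq_iff_inner_eq hc (norm_point hτ) hr, inner_add_left, real_inner_smul_left,
      real_inner_smul_left, huc', real_inner_self_eq_norm_sq, hc]
    ring
  refine ⟨_, _, norm_point rfl, norm_point (neg_sq t), norm_point_sub rfl,
    norm_point_sub (neg_sq t), ?_⟩
  have difference : (1 - r ^ 2 / 2) • c + (t / 2) • u - ((1 - r ^ 2 / 2) • c + (-t / 2) • u) =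
      t • u := by module
  rw [difference, norm_smul, hu, mul_one, Real.norm_eq_abs, sq_abs, ht_sq]

end SphericalCircle

section DiscPairing

variable {N : ℕ} {g : ClosedUnitBall N ≃ₜ ClosedUnitBall N} {c c' x y : ClosedUnitBall N} {r q : ℝ}

/-- `g` is a conformal transformation pairing the discs of radius `r` around the boundary points
`c` and `c'`: it maps the exterior of the first onto the second, and its inverse maps the exterior
of the second onto the first. -/
structure IsDiscPairing (g : ClosedUnitBall N ≃ₜ ClosedUnitBall N) (c c' : ClosedUnitBall N)
    (r : ℝ) : Prop where
  mem_confGroup : g ∈ confGroup N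
  source_mem : c ∈ bdSphere N
  target_mem : c' ∈ bdSphere N
  image_bdExt : g '' bdExt c r = bdDisc c' r
  symm_image_bdExt : g.symm '' bdExt c' r = bdDisc c r

namespace IsDiscPairing

theorem inv (hg : IsDiscPairing g c c' r) : IsDiscPairing g⁻¹ c' c r :=
  ⟨inv_mem hg.mem_confGroup, hg.target_mem, hg.source_mem, hg.symm_image_bdExt, hg.image_bdExt⟩

theorem map_mem_bdDisc (hg : IsDiscPairing g c c' r) (hx : x ∈ bdExt c r) : g x ∈ bdDisc c' r :=
  hg.image_bdExt ▸ Set.mem_image_of_mem g hx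

theorem dist_eq_of_dist_map_eq (hg : IsDiscPairing g c c' r) (hx : x ∈ bdSphere N)
    (hgx : dist (g x) c' = r) : dist x c = r := by
  refine le_antisymm (not_lt.1 fun outside => ?_) (not_lt.1 fun inside => ?_)
  · exact (hg.map_mem_bdDisc ⟨hx, outside⟩).2.ne hgx
  · obtain ⟨y, hy, hyx⟩ : x ∈ g.symm '' bdExt c' r := hg.symm_image_bdExt ▸ ⟨hx, inside⟩
    rw [← hyx, g.apply_symm_apply] at hgx
    exact hy.2.ne' hgx

theorem exists_dist_le_dist_map (hN : 1 ≤ N) (hr : 0 < r) (hr_two : r < 2)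
    (hg : IsDiscPairing g c c' r) :
    ∃ y z, dist y c = r ∧ dist z c = r ∧ dist (g y) c' = r ∧ dist (g z) c' = r ∧
      dist y z ≤ dist (g y) (g z) ∧ 0 < dist (g y) (g z) := by
  have one_lt_rank : 1 < Module.rank ℝ (Euc N) := by
    rw [← Module.finrank_eq_rank, finrank_euclideanSpace_fin]
    exact_mod_cast Nat.lt_succ_of_le hN
  obtain ⟨y', z', hy', hz', hy'r, hz'r, hyz'⟩ :=
    exists_norm_sub_sq_eq_of_norm_sub_eq one_lt_rank hg.target_mem hr.le hr_two.le
  obtain ⟨y, hy⟩ := g.surjective ⟨y', mem_closedBall_zero_iff.2 hy'.le⟩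
  obtain ⟨z, hz⟩ := g.surjective ⟨z', mem_closedBall_zero_iff.2 hz'.le⟩
  simp only [Subtype.ext_iff] at hy hz
  subst hy hz
  have hy_mem : y ∈ bdSphere N := (map_mem_bdSphere_iff hg.mem_confGroup).1 hy'
  have hz_mem : z ∈ bdSphere N := (map_mem_bdSphere_iff hg.mem_confGroup).1 hz'
  rw [← dist_eq_norm, ← Subtype.dist_eq] at hy'r hz'r hyz'
  have hyr := hg.dist_eq_of_dist_map_eq hy_mem hy'r
  have hzr := hg.dist_eq_of_dist_map_eq hz_mem hz'r
  refine ⟨y, z, hyr, hzr, hy'r, hz'r, ?_, ?_⟩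
  · refine (sq_le_sq₀ dist_nonneg dist_nonneg).1 ?_
    rw [Subtype.dist_eq, dist_eq_norm] at hyr hzr
    rw [hyz', Subtype.dist_eq, dist_eq_norm]
    exact norm_sub_sq_le_of_norm_sub_eq hg.source_mem hy_mem hz_mem hyr hzr
  · refine lt_of_pow_lt_pow_left₀ 2 dist_nonneg ?_
    rw [hyz', zero_pow two_ne_zero]
    exact mul_pos (pow_pos hr 2) (by nlinarith)

theorem confDeriv_le (hN : 1 ≤ N) (hr : 0 < r) (hr_two : r < 2) (hq : 1 < q)
    (hg : IsDiscPairing g c c' r) (hx : x ∈ bdSphere N) (hxc : q * r ≤ dist x c) :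
    confDeriv g x ≤ (2 / (q - 1)) ^ 2 := by
  obtain ⟨y, z, hy, hz, hgy, hgz, dist_le, dist_pos⟩ := hg.exists_dist_le_dist_map hN hr hr_two
  have : 0 < q - 1 := sub_pos.2 hq
  have hgx : dist (g x) c' < r := (hg.map_mem_bdDisc ⟨hx, by nlinarith⟩).2
  have far {w : ClosedUnitBall N} (hw : dist w c = r) : (q - 1) * r ≤ dist x w := by
    linarith [dist_triangle x w c]
  have near {w : ClosedUnitBall N} (hw : dist (g w) c' = r) : dist (g x) (g w) ≤ 2 * r := by
    linarith [dist_triangle_right (g x) (g w) c']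
  have hderiv := (confDeriv_pos hg.mem_confGroup x).le
  have bound : confDeriv g x * (q - 1) ^ 2 * (r ^ 2 * dist (g y) (g z)) ≤
      2 ^ 2 * (r ^ 2 * dist (g y) (g z)) :=
    calc confDeriv g x * (q - 1) ^ 2 * (r ^ 2 * dist (g y) (g z))
        = confDeriv g x * (((q - 1) * r) * ((q - 1) * r) * dist (g y) (g z)) := by ring
      _ ≤ confDeriv g x * (dist x y * dist x z * dist (g y) (g z)) := by
          gcongr
          exacts [far hy, far hz]
      _ = dist (g x) (g y) * dist (g x) (g z) * dist y z :=
          confDeriv_mul_dist_mul_dist_mul_dist_map hg.mem_confGroup x y z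
      _ ≤ (2 * r) * (2 * r) * dist (g y) (g z) := by
          gcongr
          exacts [near hgy, near hgz]
      _ = 2 ^ 2 * (r ^ 2 * dist (g y) (g z)) := by ring
  rw [div_pow, le_div_iff₀ (by positivity)]
  exact le_of_mul_le_mul_right bound (by positivity)

end IsDiscPairing

end DiscPairing

section SumsOverWords

variable {α : Type*}

theorem tsum_fin_prod (w : α → ℝ≥0∞) (k : ℕ) :
    ∑' f : Fin k → α, ∏ i, w (f i) = (∑' a, w a) ^ k := by
  induction k with
  | zero => simp [tsum_fintype]
  | succ k ih =>
    rw [← (Fin.consEquiv fun _ => α).tsum_eq, ENNReal.tsum_prod', pow_succ', ← ih,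
      ← ENNReal.tsum_mul_right]
    refine tsum_congr fun a => ?_
    rw [← ENNReal.tsum_mul_left]
    simp only [Fin.consEquiv, Equiv.coe_fn_mk, Fin.prod_univ_succ, Fin.cons_zero, Fin.cons_succ]

theorem tsum_list_prod (w : α → ℝ≥0∞) : ∑' l : List α, (l.map w).prod = (1 - ∑' a, w a)⁻¹ := by
  rw [← List.equivSigmaTuple.symm.tsum_eq, ENNReal.tsum_sigma', ← ENNReal.tsum_geometric]
  refine tsum_congr fun k => ?_
  rw [← tsum_fin_prod]
  refine tsum_congr fun f => ?_
  simp only [List.equivSigmaTuple, Equiv.coe_fn_symm_mk, List.map_ofFn, List.prod_ofFn,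
    Function.comp_apply]

end SumsOverWords

section PoincareSeries

variable {N : ℕ} {G : Subgroup (ClosedUnitBall N ≃ₜ ClosedUnitBall N)} {s : ℝ}
  {z : ClosedUnitBall N}

/-- The series `∑ j(g, z) ^ s` over `g ∈ G`, with value `∞` when it diverges: the Poincaré series
for `z` in the open ball, the horospherical Poincaré series for `z` on the boundary sphere. -/
noncomputable def poincareSeries (G : Subgroup (ClosedUnitBall N ≃ₜ ClosedUnitBall N)) (s : ℝ)
    (z : ClosedUnitBall N) : ℝ≥0∞ :=
  ∑' g : G, ENNReal.ofReal (confDeriv g.1 z ^ s)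

theorem poincareSeries_ne_top_iff (hG : G ≤ confGroup N) :
    poincareSeries G s z ≠ ∞ ↔ PoincareConverges G z s := by
  refine ⟨fun h => ?_, Summable.tsum_ofReal_ne_top⟩
  refine (ENNReal.summable_toReal h).congr fun g => ?_
  exact ENNReal.toReal_ofReal (Real.rpow_nonneg (confDeriv_pos (hG g.2) z).le s)

end PoincareSeries

namespace SchottkyData

variable {N : ℕ} {φ : ℕ → ℝ} {s : ℝ} {ζ : ClosedUnitBall N}

/-- The generator `g n` or its inverse, mapping the exterior of the disc `C n ε` onto `C n (!ε)`;
the sign convention is that of `FreeGroup.lift`. -/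
def letter (S : SchottkyData N φ) (x : ℕ × Bool) : ClosedUnitBall N ≃ₜ ClosedUnitBall N :=
  bif x.2 then S.gen x.1 else (S.gen x.1)⁻¹

/-- The transformation spelled by a word in the generators and their inverses. -/
def word (S : SchottkyData N φ) (L : List (ℕ × Bool)) : ClosedUnitBall N ≃ₜ ClosedUnitBall N :=
  (L.map S.letter).prod

variable (S : SchottkyData N φ)

theorem isDiscPairing_letter (n : ℕ) (ε : Bool) :
    IsDiscPairing (S.letter (n, ε)) (S.centre n ε) (S.centre n !ε) (S.radius n) := by
  have gen_pairing : IsDiscPairing (S.gen n) (S.centre n true) (S.centre n false) (S.radius n) :=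
    ⟨S.gen_mem n, S.centre_mem n true, S.centre_mem n false, S.gen_image n, S.gen_inv_image n⟩
  cases ε
  exacts [gen_pairing.inv, gen_pairing]

theorem word_cons (x : ℕ × Bool) (L : List (ℕ × Bool)) :
    S.word (x :: L) = S.letter x * S.word L := by
  rw [word, List.map_cons, List.prod_cons, word]

theorem word_mem_confGroup (L : List (ℕ × Bool)) : S.word L ∈ confGroup N :=
  list_prod_mem <| List.forall_mem_map.2 fun x _ => (S.isDiscPairing_letter x.1 x.2).mem_confGroup

theorem lift_gen_eq_word (x : FreeGroup ℕ) : FreeGroup.lift S.gen x = S.word x.toWord := by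
  rw [← FreeGroup.mk_toWord (x := x), FreeGroup.lift_mk, FreeGroup.mk_toWord]
  rfl

theorem lift_gen_mem_group (x : FreeGroup ℕ) : FreeGroup.lift S.gen x ∈ S.group := by
  rw [group, ← FreeGroup.range_lift_eq_closure]
  exact ⟨x, rfl⟩

theorem lift_gen_surjective :
    Function.Surjective fun x => (⟨FreeGroup.lift S.gen x, S.lift_gen_mem_group x⟩ : S.group) := by
  rintro ⟨g, hg⟩
  rw [group, ← FreeGroup.range_lift_eq_closure] at hg
  obtain ⟨x, rfl⟩ := hg
  exact ⟨x, rfl⟩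

theorem le_dist_of_mem_bdDisc (hφ : ∀ n, 1 < φ n) {x y : ℕ × Bool} (hxy : x ≠ y)
    {ξ : ClosedUnitBall N} (hξ : ξ ∈ bdDisc (S.centre x.1 x.2) (S.radius x.1)) :
    φ y.1 * S.radius y.1 ≤ dist ξ (S.centre y.1 y.2) := by
  have hx : ξ ∈ bdDisc (S.centre x.1 x.2) (φ x.1 * S.radius x.1) :=
    ⟨hξ.1, hξ.2.trans_le (le_mul_of_one_le_left (S.radius_pos _).le (hφ _).le)⟩
  by_contra! hy
  exact Set.disjoint_left.1 (S.disjoint_enlarged _ _ _ _ hxy) hx ⟨hξ.1, hy⟩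

theorem le_dist_word (hφ : ∀ n, 1 < φ n) (hζ : ζ ∈ bdSphere N)
    (hζ_out : ∀ n ε, φ n * S.radius n ≤ dist ζ (S.centre n ε)) {x : ℕ × Bool}
    {L : List (ℕ × Bool)} (hL : FreeGroup.IsReduced (x :: L)) :
    φ x.1 * S.radius x.1 ≤ dist (S.word L ζ) (S.centre x.1 x.2) := by
  induction L generalizing x with
  | nil => exact hζ_out _ _
  | cons y L ih =>
    obtain ⟨no_cancellation, hyL⟩ := FreeGroup.isReduced_cons_cons.1 hL
    have distinct_discs : (y.1, !y.2) ≠ x := by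
      rintro rfl
      exact Bool.not_ne_self _ (no_cancellation rfl)
    refine S.le_dist_of_mem_bdDisc hφ distinct_discs ?_
    rw [word_cons]
    refine (S.isDiscPairing_letter _ _).map_mem_bdDisc
      ⟨(map_mem_bdSphere_iff (S.word_mem_confGroup L)).2 hζ, ?_⟩
    exact (lt_mul_of_one_lt_left (S.radius_pos _) (hφ _)).trans_le (ih hyL)

theorem ofReal_confDeriv_letter_rpow_le (hN : 1 ≤ N) (hs : 0 ≤ s) {x : ℕ × Bool}
    (hφ : 1 < φ x.1) (hζ : ζ ∈ bdSphere N)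
    (hζ_out : φ x.1 * S.radius x.1 ≤ dist ζ (S.centre x.1 x.2)) :
    ENNReal.ofReal (confDeriv (S.letter x) ζ ^ s) ≤
      ENNReal.ofReal ((2 / (φ x.1 - 1)) ^ (2 * s)) := by
  have pairing := S.isDiscPairing_letter x.1 x.2
  have : 0 < φ x.1 - 1 := sub_pos.2 hφ
  rw [Real.rpow_mul (by positivity), Real.rpow_two]
  gcongr
  · exact (confDeriv_pos pairing.mem_confGroup ζ).le
  · exact pairing.confDeriv_le hN (S.radius_pos _) ((S.radius_lt_one _).trans one_lt_two) hφ hζ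
      hζ_out

theorem ofReal_confDeriv_word_rpow_le (hN : 1 ≤ N) (hs : 0 ≤ s) (hφ : ∀ n, 1 < φ n)
    (hζ : ζ ∈ bdSphere N) (hζ_out : ∀ n ε, φ n * S.radius n ≤ dist ζ (S.centre n ε))
    {L : List (ℕ × Bool)} (hL : FreeGroup.IsReduced L) :
    ENNReal.ofReal (confDeriv (S.word L) ζ ^ s) ≤
      (L.map fun x => ENNReal.ofReal ((2 / (φ x.1 - 1)) ^ (2 * s))).prod := by
  induction L with
  | nil => simp [word, confDeriv_one]
  | cons x L ih =>
    have hx : S.letter x ∈ confGroup N := (S.isDiscPairing_letter x.1 x.2).mem_confGroup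
    have hword := S.word_mem_confGroup L
    have hderiv_letter := (confDeriv_pos hx (S.word L ζ)).le
    rw [word_cons, confDeriv_mul hx hword,
      Real.mul_rpow hderiv_letter (confDeriv_pos hword ζ).le,
      ENNReal.ofReal_mul (Real.rpow_nonneg hderiv_letter s), List.map_cons, List.prod_cons]
    refine mul_le_mul' ?_ (ih (hL.infix (List.suffix_cons x L).isInfix))
    exact S.ofReal_confDeriv_letter_rpow_le hN hs (hφ _) ((map_mem_bdSphere_iff hword).2 hζ)
      (S.le_dist_word hφ hζ hζ_out hL)

-- The subtraction is truncated: if the sum is at least `1 / 2`, the right-hand side is `∞`.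
theorem poincareSeries_group_le (hN : 1 ≤ N) (hs : 0 ≤ s) (hφ : ∀ n, 1 < φ n)
    (hζ : ζ ∈ bdSphere N) (hζ_out : ∀ n ε, φ n * S.radius n ≤ dist ζ (S.centre n ε)) :
    poincareSeries S.group s ζ ≤
      (1 - 2 * ∑' n, ENNReal.ofReal ((2 / (φ n - 1)) ^ (2 * s)))⁻¹ := by
  set weight : ℕ × Bool → ℝ≥0∞ := fun x => ENNReal.ofReal ((2 / (φ x.1 - 1)) ^ (2 * s))
  calc poincareSeries S.group s ζ
      ≤ ∑' x : FreeGroup ℕ, ENNReal.ofReal (confDeriv (FreeGroup.lift S.gen x) ζ ^ s) :=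
        ENNReal.tsum_le_tsum_comp_of_surjective S.lift_gen_surjective _
    _ ≤ ∑' x : FreeGroup ℕ, (x.toWord.map weight).prod := by
        refine ENNReal.tsum_le_tsum fun x => ?_
        rw [lift_gen_eq_word]
        exact S.ofReal_confDeriv_word_rpow_le hN hs hφ hζ hζ_out FreeGroup.isReduced_toWord
    _ ≤ ∑' L : List (ℕ × Bool), (L.map weight).prod :=
        ENNReal.tsum_comp_le_tsum_of_injective FreeGroup.toWord_injective _
    _ = (1 - ∑' x, weight x)⁻¹ := tsum_list_prod weight
    _ = (1 - 2 * ∑' n, ENNReal.ofReal ((2 / (φ n - 1)) ^ (2 * s)))⁻¹ := by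
        simp only [weight, ENNReal.tsum_prod', tsum_fintype, Finset.sum_const, Finset.card_univ,
          Fintype.card_bool, nsmul_eq_mul, Nat.cast_ofNat, ENNReal.tsum_mul_left]

theorem poincareConverges_group (hN : 1 ≤ N) (hs : 0 ≤ s) (hφ : ∀ n, 1 < φ n)
    (hφ_sum : ∑' n, ENNReal.ofReal ((2 / (φ n - 1)) ^ (2 * s)) < 2⁻¹) (hζ : ζ ∈ bdSphere N)
    (hζ_out : ∀ n ε, φ n * S.radius n ≤ dist ζ (S.centre n ε)) :
    PoincareConverges S.group ζ s := by
  rw [← poincareSeries_ne_top_iff S.group_le]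
  refine ne_top_of_le_ne_top (ENNReal.inv_ne_top.2 (tsub_pos_of_lt ?_).ne')
    (S.poincareSeries_group_le hN hs hφ hζ hζ_out)
  rw [← ENNReal.mul_inv_cancel two_ne_zero ENNReal.ofNat_ne_top]
  exact ENNReal.mul_lt_mul_right two_ne_zero ENNReal.ofNat_ne_top hφ_sum

end SchottkyData

section HyperbolicEstimates

theorem cosh_half_sq_le_exp {t : ℝ} (ht : 0 ≤ t) : Real.cosh (t / 2) ^ 2 ≤ Real.exp t := by
  have cosh_le : Real.cosh (t / 2) ≤ Real.exp (t / 2) := by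
    linarith [Real.cosh_add_sinh (t / 2), Real.sinh_nonneg_iff.2 (div_nonneg ht zero_le_two)]
  calc Real.cosh (t / 2) ^ 2 ≤ Real.exp (t / 2) ^ 2 :=
        pow_le_pow_left₀ (Real.cosh_pos _).le cosh_le 2
    _ = Real.exp t := by rw [← Real.exp_nat_mul, Nat.cast_two, mul_div_cancel₀ _ two_ne_zero]

theorem sinh_sub_le_exp_neg_mul_sinh (x : ℝ) {y : ℝ} (hy : 0 ≤ y) :
    Real.sinh (x - y) ≤ Real.exp (-y) * Real.sinh x := by
  have exp_le : Real.exp (-y - x) ≤ Real.exp (y - x) := Real.exp_le_exp.2 (by linarith)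
  have exp_mul_sinh :
      Real.exp (-y) * Real.sinh x = (Real.exp (x - y) - Real.exp (-y - x)) / 2 := by
    rw [Real.sinh_eq, sub_eq_add_neg x, sub_eq_add_neg (-y), Real.exp_add, Real.exp_add]
    ring
  rw [exp_mul_sinh, Real.sinh_eq, neg_sub]
  linarith

variable {N : ℕ} {x y : ClosedUnitBall N}

theorem confDenom_eq_cosh_half_hypDist_sq_mul (hx : x ∈ hypBall N) (hy : y ∈ hypBall N) :
    confDenom (x : Euc N) y =
      Real.cosh (hypDist x y / 2) ^ 2 * ((1 - ‖(x : Euc N)‖ ^ 2) * (1 - ‖(y : Euc N)‖ ^ 2)) := by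
  rw [Real.cosh_sq, add_mul, ← dist_sq_eq_sinh_half_hypDist_sq_mul hx hy, one_mul, confDenom_eq,
    Subtype.dist_eq, dist_eq_norm]

theorem confDenom_le_exp_hypDist_mul (hx : x ∈ hypBall N) (hy : y ∈ hypBall N) :
    confDenom (x : Euc N) y ≤
      Real.exp (hypDist x y) * ((1 - ‖(x : Euc N)‖ ^ 2) * (1 - ‖(y : Euc N)‖ ^ 2)) := by
  rw [confDenom_eq_cosh_half_hypDist_sq_mul hx hy]
  exact mul_le_mul_of_nonneg_right (cosh_half_sq_le_exp (hypDist_nonneg x y))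
    (mul_nonneg (one_sub_norm_sq_nonneg x) (one_sub_norm_sq_nonneg y))

theorem one_sub_norm_sq_le_exp_hypDist_mul (hx : x ∈ hypBall N) (hy : y ∈ hypBall N) :
    1 - ‖(y : Euc N)‖ ^ 2 ≤ 4 * Real.exp (hypDist x y) * (1 - ‖(x : Euc N)‖ ^ 2) := by
  have hx_le := norm_coe_le_one x
  have hy_le := norm_coe_le_one y
  have hy_nonneg := norm_nonneg (y : Euc N)
  have one_sub_norm_sq_le : 1 - ‖(y : Euc N)‖ ^ 2 ≤ 2 * (1 - ‖(x : Euc N)‖ * ‖(y : Euc N)‖) := by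
    nlinarith
  refine le_of_mul_le_mul_right ?_ (one_sub_norm_sq_pos hy)
  calc (1 - ‖(y : Euc N)‖ ^ 2) * (1 - ‖(y : Euc N)‖ ^ 2)
      = (1 - ‖(y : Euc N)‖ ^ 2) ^ 2 := (sq _).symm
    _ ≤ (2 * (1 - ‖(x : Euc N)‖ * ‖(y : Euc N)‖)) ^ 2 :=
        pow_le_pow_left₀ (one_sub_norm_sq_nonneg y) one_sub_norm_sq_le 2
    _ = 4 * (1 - ‖(x : Euc N)‖ * ‖(y : Euc N)‖) ^ 2 := by ring
    _ ≤ 4 * (Real.exp (hypDist x y) * ((1 - ‖(x : Euc N)‖ ^ 2) * (1 - ‖(y : Euc N)‖ ^ 2))) := by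
        gcongr
        exact (sq_one_sub_mul_le_confDenom _ _).trans (confDenom_le_exp_hypDist_mul hx hy)
    _ = _ := by ring

theorem dist_le_exp_hypDist_mul (hx : x ∈ hypBall N) (hy : y ∈ hypBall N) :
    dist x y ≤ 2 * Real.exp (hypDist x y) * (1 - ‖(x : Euc N)‖ ^ 2) := by
  have hx_pos := one_sub_norm_sq_pos hx
  refine (sq_le_sq₀ dist_nonneg (by positivity)).1 ?_
  calc dist x y ^ 2
      ≤ confDenom (x : Euc N) y := by
        rw [confDenom_eq, Subtype.dist_eq, dist_eq_norm]
        exact le_add_of_nonneg_right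
          (mul_nonneg (one_sub_norm_sq_nonneg x) (one_sub_norm_sq_nonneg y))
    _ ≤ Real.exp (hypDist x y) * ((1 - ‖(x : Euc N)‖ ^ 2) * (1 - ‖(y : Euc N)‖ ^ 2)) :=
        confDenom_le_exp_hypDist_mul hx hy
    _ ≤ Real.exp (hypDist x y) * ((1 - ‖(x : Euc N)‖ ^ 2) *
          (4 * Real.exp (hypDist x y) * (1 - ‖(x : Euc N)‖ ^ 2))) := by
        gcongr
        exact one_sub_norm_sq_le_exp_hypDist_mul hx hy
    _ = _ := by ring

end HyperbolicEstimates

section StolzRegion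

variable {N : ℕ} {ζ y z : ClosedUnitBall N} {K C : ℝ}

/-- The Stolz region at `ζ` of aperture `K`, where the distance to `ζ` is at most `K` times the
distance to the boundary sphere. The latter is measured by `1 - |z|²`, which is comparable with
`1 - |z|` and transforms well under conformal maps. -/
def stolzRegion (ζ : ClosedUnitBall N) (K : ℝ) : Set (ClosedUnitBall N) :=
  {z | dist z ζ ≤ K * (1 - ‖(z : Euc N)‖ ^ 2)}

theorem mem_stolzRegion_of_hypDist_le (hK : 0 ≤ K) (hy : y ∈ hypBall N) (hz : z ∈ hypBall N)
    (hzy : hypDist z y ≤ C) (hyζ : y ∈ stolzRegion ζ K) :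
    z ∈ stolzRegion ζ ((4 * K + 2) * Real.exp C) := by
  have hz_pos := one_sub_norm_sq_pos hz
  calc dist z ζ ≤ dist y ζ + dist z y := (dist_triangle z y ζ).trans_eq (add_comm _ _)
    _ ≤ K * (1 - ‖(y : Euc N)‖ ^ 2) + 2 * Real.exp (hypDist z y) * (1 - ‖(z : Euc N)‖ ^ 2) :=
        add_le_add hyζ (dist_le_exp_hypDist_mul hz hy)
    _ ≤ K * (4 * Real.exp (hypDist z y) * (1 - ‖(z : Euc N)‖ ^ 2)) +
          2 * Real.exp (hypDist z y) * (1 - ‖(z : Euc N)‖ ^ 2) := by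
        gcongr
        exact one_sub_norm_sq_le_exp_hypDist_mul hz hy
    _ = (4 * K + 2) * Real.exp (hypDist z y) * (1 - ‖(z : Euc N)‖ ^ 2) := by ring
    _ ≤ (4 * K + 2) * Real.exp C * (1 - ‖(z : Euc N)‖ ^ 2) := by gcongr

variable {γ : ℝ → ClosedUnitBall N} {t u : ℝ}

theorem dist_sq_mul_le_exp_neg_mul (hγ : IsGeodesicRay γ ζ) (ht : 0 ≤ t) (htu : t ≤ u) :
    dist (γ u) (γ t) ^ 2 * (1 - ‖(γ 0 : Euc N)‖ ^ 2) ≤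
      4 * Real.exp (-t) * (1 - ‖(γ t : Euc N)‖ ^ 2) := by
  obtain ⟨mem_hypBall, hypDist_eq, -⟩ := hγ
  have hu : 0 ≤ u := ht.trans htu
  have sinh_decay : Real.sinh ((u - t) / 2) ^ 2 ≤ Real.exp (-t) * Real.sinh (u / 2) ^ 2 := by
    have decay := pow_le_pow_left₀ (Real.sinh_nonneg_iff.2 (by linarith))
      (sinh_sub_le_exp_neg_mul_sinh (u / 2) (div_nonneg ht zero_le_two)) 2
    rwa [mul_pow, ← Real.exp_nat_mul, Nat.cast_two, mul_neg, mul_div_cancel₀ _ two_ne_zero,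
      ← sub_div] at decay
  have dist_ut := dist_sq_eq_sinh_half_hypDist_sq_mul (mem_hypBall u hu) (mem_hypBall t ht)
  have dist_u0 := dist_sq_eq_sinh_half_hypDist_sq_mul (mem_hypBall u hu) (mem_hypBall 0 le_rfl)
  rw [hypDist_eq u t hu ht, abs_of_nonneg (sub_nonneg.2 htu)] at dist_ut
  rw [hypDist_eq u 0 hu le_rfl, sub_zero, abs_of_nonneg hu] at dist_u0
  have h0 := one_sub_norm_sq_nonneg (γ 0)
  have ht := one_sub_norm_sq_nonneg (γ t)
  have hu := one_sub_norm_sq_nonneg (γ u)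
  calc dist (γ u) (γ t) ^ 2 * (1 - ‖(γ 0 : Euc N)‖ ^ 2)
      ≤ Real.exp (-t) * Real.sinh (u / 2) ^ 2 *
          ((1 - ‖(γ u : Euc N)‖ ^ 2) * (1 - ‖(γ t : Euc N)‖ ^ 2)) *
          (1 - ‖(γ 0 : Euc N)‖ ^ 2) := by rw [dist_ut]; gcongr
    _ = dist (γ u) (γ 0) ^ 2 * Real.exp (-t) * (1 - ‖(γ t : Euc N)‖ ^ 2) := by rw [dist_u0]; ring
    _ ≤ 2 ^ 2 * Real.exp (-t) * (1 - ‖(γ t : Euc N)‖ ^ 2) := by gcongr; exact dist_le_two _ _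
    _ = 4 * Real.exp (-t) * (1 - ‖(γ t : Euc N)‖ ^ 2) := by norm_num

theorem mem_stolzRegion_of_isGeodesicRay (hγ : IsGeodesicRay γ ζ) (ht : 0 ≤ t) :
    γ t ∈ stolzRegion ζ (4 / (1 - ‖(γ 0 : Euc N)‖ ^ 2)) := by
  have h0_pos := one_sub_norm_sq_pos (hγ.1 0 le_rfl)
  have ht_nonneg := one_sub_norm_sq_nonneg (γ t)
  have dist_limit_sq : dist ζ (γ t) ^ 2 * (1 - ‖(γ 0 : Euc N)‖ ^ 2) ≤
      4 * Real.exp (-t) * (1 - ‖(γ t : Euc N)‖ ^ 2) :=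
    le_of_tendsto (((hγ.2.2.2.dist tendsto_const_nhds).pow 2).mul_const _)
      ((eventually_ge_atTop t).mono fun u htu => dist_sq_mul_le_exp_neg_mul hγ ht htu)
  have harnack := one_sub_norm_sq_le_exp_hypDist_mul (hγ.1 t ht) (hγ.1 0 le_rfl)
  rw [hγ.2.1 t 0 ht le_rfl, sub_zero, abs_of_nonneg ht] at harnack
  have exp_mul_exp : Real.exp (-t) * Real.exp t = 1 := by rw [← Real.exp_add]; simp
  rw [stolzRegion, Set.mem_ofPred_eq, div_mul_eq_mul_div, le_div_iff₀ h0_pos, dist_comm]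
  refine (sq_le_sq₀ (by positivity) (by positivity)).1 ?_
  calc (dist ζ (γ t) * (1 - ‖(γ 0 : Euc N)‖ ^ 2)) ^ 2
      = dist ζ (γ t) ^ 2 * (1 - ‖(γ 0 : Euc N)‖ ^ 2) * (1 - ‖(γ 0 : Euc N)‖ ^ 2) := by ring
    _ ≤ 4 * Real.exp (-t) * (1 - ‖(γ t : Euc N)‖ ^ 2) *
          (4 * Real.exp t * (1 - ‖(γ t : Euc N)‖ ^ 2)) := by gcongr
    _ = (4 * (1 - ‖(γ t : Euc N)‖ ^ 2)) ^ 2 := by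
        linear_combination (16 * (1 - ‖(γ t : Euc N)‖ ^ 2) ^ 2) * exp_mul_exp

variable {G : Subgroup (ClosedUnitBall N ≃ₜ ClosedUnitBall N)} {w : ClosedUnitBall N}

theorem IsEndingSequence.exists_mem_stolzRegion {z : ℕ → ClosedUnitBall N}
    (hz : IsEndingSequence G w ζ z) : ∃ K, 0 ≤ K ∧ ∀ n, z n ∈ stolzRegion ζ K := by
  obtain ⟨mem_domain, ⟨γ, hγ, -, C, near_ray⟩, -⟩ := hz
  have h0 := one_sub_norm_sq_nonneg (γ 0)
  refine ⟨(4 * (4 / (1 - ‖(γ 0 : Euc N)‖ ^ 2)) + 2) * Real.exp C, by positivity, fun n => ?_⟩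
  obtain ⟨t, ht, hC⟩ := near_ray n
  exact mem_stolzRegion_of_hypDist_le (by positivity) (hγ.1 t ht) (mem_domain n).1 hC
    (mem_stolzRegion_of_isGeodesicRay hγ ht)

end StolzRegion

section DerivativeComparison

theorem confDenom_le_sq_mul_confDenom {E : Type*} [NormedAddCommGroup E] [InnerProductSpace ℝ E]
    {ζ z a : E} {K B : ℝ} (hK : 0 ≤ K) (hB : 0 ≤ B) (hζ : ‖ζ‖ = 1) (hz : ‖z‖ ≤ 1) (ha : ‖a‖ ≤ 1)
    (hzζ : ‖z - ζ‖ ≤ K * (1 - ‖z‖ ^ 2)) (haB : 1 - ‖a‖ ^ 2 ≤ B * confDenom z a) :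
    confDenom ζ a ≤ (2 * K * (B + 1) + 1) ^ 2 * confDenom z a := by
  have norm_sub_sq_le : ‖z - a‖ ^ 2 ≤ confDenom z a := by
    rw [confDenom_eq]
    exact le_add_of_nonneg_right (mul_nonneg (sub_nonneg.2 (pow_le_one₀ (norm_nonneg z) hz))
      (sub_nonneg.2 (pow_le_one₀ (norm_nonneg a) ha)))
  set δ := √(confDenom z a)
  have δ_sq : δ ^ 2 = confDenom z a := Real.sq_sqrt ((sq_nonneg _).trans norm_sub_sq_le)
  have : 0 ≤ δ := Real.sqrt_nonneg _
  have δ_le_two : δ ≤ 2 := Real.sqrt_le_iff.2 ⟨zero_le_two, by linarith [confDenom_le_four hz ha]⟩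
  have norm_sub_le : ‖z - a‖ ≤ δ := Real.le_sqrt_of_sq_le norm_sub_sq_le
  have one_sub_norm_sq_le : 1 - ‖z‖ ^ 2 ≤ 2 * (B + 1) * δ :=
    calc 1 - ‖z‖ ^ 2 = 1 - ‖a‖ ^ 2 + (‖a‖ + ‖z‖) * (‖a‖ - ‖z‖) := by ring
      _ ≤ B * confDenom z a + (‖a‖ + ‖z‖) * ‖a - z‖ := by
          gcongr
          exact norm_sub_norm_le a z
      _ ≤ B * (2 * δ) + (1 + 1) * δ := by
          rw [norm_sub_rev, ← δ_sq, sq]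
          gcongr
      _ = 2 * (B + 1) * δ := by ring
  rw [confDenom_eq, hζ, one_pow, sub_self, zero_mul, add_zero, ← δ_sq, ← mul_pow]
  refine pow_le_pow_left₀ (norm_nonneg _) ?_ 2
  calc ‖ζ - a‖ ≤ ‖z - ζ‖ + ‖z - a‖ := by
        rw [norm_sub_rev z ζ]
        exact norm_sub_le_norm_sub_add_norm_sub ζ z a
    _ ≤ K * (2 * (B + 1) * δ) + δ := by
        gcongr
        exact hzζ.trans (by gcongr)
    _ = (2 * K * (B + 1) + 1) * δ := by ring

variable {N : ℕ} {G : Subgroup (ClosedUnitBall N ≃ₜ ClosedUnitBall N)}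
  {g : ClosedUnitBall N ≃ₜ ClosedUnitBall N} {w z ζ : ClosedUnitBall N} {K B : ℝ}

theorem confDeriv_le_mul_confDeriv_of_mem_stolzRegion (hg : g ∈ confGroup N) (hK : 0 ≤ K)
    (hζ : ζ ∈ bdSphere N) (hz : z ∈ stolzRegion ζ K) (hB : confDeriv g z ≤ B) :
    confDeriv g z ≤ (2 * K * (B + 1) + 1) ^ 2 * confDeriv g ζ := by
  have denom_pos := confDenom_inv_origin_pos hg z
  have denom_pos' := confDenom_inv_origin_pos hg ζ
  have ha := one_sub_norm_sq_nonneg (g⁻¹ (origin N))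
  have hB_nonneg : 0 ≤ B := (confDeriv_pos hg z).le.trans hB
  rw [confDeriv_eq, div_le_iff₀ denom_pos] at hB
  rw [stolzRegion, Set.mem_ofPred_eq, Subtype.dist_eq, dist_eq_norm] at hz
  have denom_le := confDenom_le_sq_mul_confDenom hK hB_nonneg hζ (norm_coe_le_one z)
    (norm_coe_le_one _) hz hB
  rw [confDeriv_eq, confDeriv_eq, ← mul_div_assoc, div_le_div_iff₀ denom_pos denom_pos']
  calc (1 - ‖(g⁻¹ (origin N) : Euc N)‖ ^ 2) * confDenom (ζ : Euc N) (g⁻¹ (origin N) : Euc N)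
      ≤ (1 - ‖(g⁻¹ (origin N) : Euc N)‖ ^ 2) * ((2 * K * (B + 1) + 1) ^ 2 *
          confDenom (z : Euc N) (g⁻¹ (origin N) : Euc N)) := by gcongr
    _ = _ := by ring

theorem confDeriv_le_mul_confDeriv_of_mem_hypBall (hg : g ∈ confGroup N) (hz : z ∈ hypBall N)
    (ζ : ClosedUnitBall N) : confDeriv g z ≤ 4 / (1 - ‖(z : Euc N)‖) ^ 2 * confDeriv g ζ := by
  have hz_pos : 0 < 1 - ‖(z : Euc N)‖ := sub_pos.2 hz
  have ha := one_sub_norm_sq_nonneg (g⁻¹ (origin N))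
  have denom_ge : (1 - ‖(z : Euc N)‖) ^ 2 ≤ confDenom (z : Euc N) (g⁻¹ (origin N) : Euc N) := by
    refine le_trans (pow_le_pow_left₀ hz_pos.le ?_ 2) (sq_one_sub_mul_le_confDenom _ _)
    exact sub_le_sub_left (mul_le_of_le_one_right (norm_nonneg _) (norm_coe_le_one _)) 1
  have denom_le := confDenom_le_four (norm_coe_le_one ζ) (norm_coe_le_one (g⁻¹ (origin N)))
  have denom_pos := confDenom_inv_origin_pos hg ζ
  calc confDeriv g z
      ≤ (1 - ‖(g⁻¹ (origin N) : Euc N)‖ ^ 2) / (1 - ‖(z : Euc N)‖) ^ 2 := by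
        rw [confDeriv_eq]
        gcongr
    _ = 4 / (1 - ‖(z : Euc N)‖) ^ 2 * ((1 - ‖(g⁻¹ (origin N) : Euc N)‖ ^ 2) / 4) := by ring
    _ ≤ 4 / (1 - ‖(z : Euc N)‖) ^ 2 * confDeriv g ζ := by
        rw [confDeriv_eq]
        gcongr

theorem hypDist_le_hypDist_map (hG : G ≤ confGroup N) (hw : w ∈ hypBall N)
    (hz : z ∈ dirichletDomain G w) (hg : g ∈ G) : hypDist z w ≤ hypDist (g z) w := by
  rcases eq_or_ne g 1 with rfl | hg_ne
  · exact le_rfl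
  calc hypDist z w ≤ hypDist z (g⁻¹ w) := (hz.2 g⁻¹ (inv_mem hg) (inv_ne_one.2 hg_ne)).le
    _ = hypDist (g z) (g (g⁻¹ w)) :=
        (hypDist_map_map (hG hg) hz.1 ((map_mem_hypBall_iff (inv_mem (hG hg))).2 hw)).symm
    _ = hypDist (g z) w := congrArg _ (g.apply_symm_apply w)

theorem confDeriv_mul_dist_sq_le_dist_map_sq (hg : g ∈ confGroup N) (hz : z ∈ hypBall N)
    (hw : w ∈ hypBall N) (hzw : hypDist z w ≤ hypDist (g z) w) :
    confDeriv g z * dist z w ^ 2 ≤ dist (g z) w ^ 2 := by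
  have hderiv := confDeriv_pos hg z
  have hz_pos := one_sub_norm_sq_pos hz
  have hw_pos := one_sub_norm_sq_pos hw
  have sinh_le : Real.sinh (hypDist z w / 2) ^ 2 ≤ Real.sinh (hypDist (g z) w / 2) ^ 2 :=
    pow_le_pow_left₀ (Real.sinh_nonneg_iff.2 (div_nonneg (hypDist_nonneg z w) zero_le_two))
      (Real.sinh_le_sinh.2 (by linarith)) 2
  rw [dist_sq_eq_sinh_half_hypDist_sq_mul hz hw,
    dist_sq_eq_sinh_half_hypDist_sq_mul ((map_mem_hypBall_iff hg).2 hz) hw,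
    one_sub_norm_sq_map hg hz]
  calc confDeriv g z * (Real.sinh (hypDist z w / 2) ^ 2 *
        ((1 - ‖(z : Euc N)‖ ^ 2) * (1 - ‖(w : Euc N)‖ ^ 2)))
      = Real.sinh (hypDist z w / 2) ^ 2 *
          (confDeriv g z * (1 - ‖(z : Euc N)‖ ^ 2) * (1 - ‖(w : Euc N)‖ ^ 2)) := by ring
    _ ≤ _ := by gcongr

theorem confDeriv_le_of_mem_dirichletDomain (hG : G ≤ confGroup N) (hw : w ∈ hypBall N)
    (hz : z ∈ dirichletDomain G w) (hg : g ∈ G) (hzw : z ≠ w) :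
    confDeriv g z ≤ 4 / dist z w ^ 2 := by
  rw [le_div_iff₀ (pow_pos (dist_pos.2 hzw) 2)]
  calc confDeriv g z * dist z w ^ 2 ≤ dist (g z) w ^ 2 :=
        confDeriv_mul_dist_sq_le_dist_map_sq (hG hg) hz.1 hw (hypDist_le_hypDist_map hG hw hz hg)
    _ ≤ 2 ^ 2 := pow_le_pow_left₀ dist_nonneg (dist_le_two _ _) 2
    _ = 4 := by norm_num

theorem IsEndingSequence.exists_eventually_confDeriv_le (hG : G ≤ confGroup N)
    (hw : w ∈ hypBall N) {z : ℕ → ClosedUnitBall N} (hz : IsEndingSequence G w ζ z) :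
    ∃ M, 0 ≤ M ∧ ∀ᶠ n in atTop, ∀ g ∈ G, confDeriv g (z n) ≤ M * confDeriv g ζ := by
  obtain ⟨K, hK, hz_stolz⟩ := hz.exists_mem_stolzRegion
  obtain ⟨hz_domain, ⟨γ, ⟨-, -, hζ, -⟩, -⟩, hz_lim⟩ := hz
  have hζw : 0 < dist ζ w := dist_pos.2 fun h => notMem_hypBall_iff.2 hζ (h ▸ hw)
  refine ⟨(2 * K * (4 / (dist ζ w / 2) ^ 2 + 1) + 1) ^ 2, sq_nonneg _, ?_⟩
  filter_upwards [(hz_lim.dist tendsto_const_nhds).eventually_const_lt (half_lt_self hζw)]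
    with n hn g hg
  refine confDeriv_le_mul_confDeriv_of_mem_stolzRegion (hG hg) hK hζ (hz_stolz n) ?_
  have hzw : z n ≠ w := dist_pos.1 ((half_pos hζw).trans hn)
  exact (confDeriv_le_of_mem_dirichletDomain hG hw (hz_domain n) hg hzw).trans (by gcongr)

theorem PoincareConverges.of_mem_hypBall {s : ℝ} (hG : G ≤ confGroup N) (hs : 0 ≤ s)
    (hζ : PoincareConverges G ζ s) (hz : z ∈ hypBall N) : PoincareConverges G z s := by
  refine Summable.of_nonneg_of_le (fun g => Real.rpow_nonneg (confDeriv_pos (hG g.2) z).le s)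
    (fun g => ?_) (hζ.mul_left ((4 / (1 - ‖(z : Euc N)‖) ^ 2) ^ s))
  rw [← Real.mul_rpow (by positivity) (confDeriv_pos (hG g.2) ζ).le]
  exact Real.rpow_le_rpow (confDeriv_pos (hG g.2) z).le
    (confDeriv_le_mul_confDeriv_of_mem_hypBall (hG g.2) hz ζ) hs

end DerivativeComparison

section OrbitMeasure

variable {N : ℕ} {G : Subgroup (ClosedUnitBall N ≃ₜ ClosedUnitBall N)} {s : ℝ}
  {z ζ : ClosedUnitBall N}

theorem orbitMeasure_apply {A : Set (ClosedUnitBall N)} (hA : MeasurableSet A) :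
    orbitMeasure G s z A = (poincareSeries G s z)⁻¹ *
      ∑' g : G, ENNReal.ofReal (confDeriv g.1 z ^ s) * A.indicator 1 (g.1 z) := by
  simp only [orbitMeasure, poincareSeries, Measure.smul_apply, Measure.sum_apply _ hA, smul_eq_mul,
    Measure.dirac_apply' _ hA]

theorem lintegral_orbitMeasure (f : ClosedUnitBall N → ℝ≥0∞) :
    ∫⁻ x, f x ∂orbitMeasure G s z = (poincareSeries G s z)⁻¹ *
      ∑' g : G, ENNReal.ofReal (confDeriv g.1 z ^ s) * f (g.1 z) := by
  simp only [orbitMeasure, poincareSeries, lintegral_smul_measure, lintegral_sum_measure,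
    lintegral_dirac, smul_eq_mul]

theorem poincareSeries_ne_zero (G : Subgroup (ClosedUnitBall N ≃ₜ ClosedUnitBall N)) (s : ℝ)
    (z : ClosedUnitBall N) : poincareSeries G s z ≠ 0 := by
  refine ne_of_gt (lt_of_lt_of_le ?_ (ENNReal.le_tsum (1 : G)))
  exact ENNReal.ofReal_pos.2 (Real.rpow_pos_of_pos (confDeriv_pos (one_mem _) z) s)

theorem toReal_poincareSeries (hG : G ≤ confGroup N) :
    (poincareSeries G s z).toReal = ∑' g : G, confDeriv g.1 z ^ s := by
  rw [poincareSeries, ENNReal.tsum_toReal_eq fun _ => ENNReal.ofReal_ne_top]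
  exact tsum_congr fun g =>
    ENNReal.toReal_ofReal (Real.rpow_nonneg (confDeriv_pos (hG g.2) z).le s)

theorem tsum_confDeriv_rpow_ne_zero (hG : G ≤ confGroup N) (h : PoincareConverges G z s) :
    ∑' g : G, confDeriv g.1 z ^ s ≠ 0 := by
  rw [← toReal_poincareSeries hG]
  exact ENNReal.toReal_ne_zero.2 ⟨poincareSeries_ne_zero G s z, (poincareSeries_ne_top_iff hG).2 h⟩

theorem isProbabilityMeasure_orbitMeasure (hG : G ≤ confGroup N) (h : PoincareConverges G z s) :
    IsProbabilityMeasure (orbitMeasure G s z) := by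
  constructor
  simp only [orbitMeasure_apply MeasurableSet.univ, Set.indicator_univ, Pi.one_apply, mul_one]
  exact ENNReal.inv_mul_cancel (poincareSeries_ne_zero G s z) ((poincareSeries_ne_top_iff hG).2 h)

theorem integral_orbitMeasure (hG : G ≤ confGroup N) (h : PoincareConverges G z s)
    (f : C(ClosedUnitBall N, ℝ)) :
    ∫ x, f x ∂orbitMeasure G s z =
      (∑' g : G, confDeriv g.1 z ^ s)⁻¹ * ∑' g : G, confDeriv g.1 z ^ s * f (g.1 z) := by
  have := isProbabilityMeasure_orbitMeasure hG h
  have f_integrable : Integrable f (orbitMeasure G s z) :=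
    f.continuous.integrable_of_hasCompactSupport (HasCompactSupport.of_compactSpace f)
  have inv_ne_zero : (poincareSeries G s z)⁻¹ ≠ 0 :=
    ENNReal.inv_ne_zero.2 ((poincareSeries_ne_top_iff hG).2 h)
  have inv_ne_top : (poincareSeries G s z)⁻¹ ≠ ∞ :=
    ENNReal.inv_ne_top.2 (poincareSeries_ne_zero G s z)
  have f_integrable_sum := (integrable_smul_measure inv_ne_zero inv_ne_top).1 f_integrable
  rw [← toReal_poincareSeries hG, ← ENNReal.toReal_inv, orbitMeasure, integral_smul_measure,
    integral_sum_measure f_integrable_sum, smul_eq_mul]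
  refine congrArg _ (tsum_congr fun g => ?_)
  rw [integral_smul_measure, integral_dirac,
    ENNReal.toReal_ofReal (Real.rpow_nonneg (confDeriv_pos (hG g.2) z).le s), smul_eq_mul]

theorem tendsto_tsum_confDeriv_rpow_mul (hG : G ≤ confGroup N) (hs : 0 ≤ s)
    (hζ : PoincareConverges G ζ s) {z : ℕ → ClosedUnitBall N} (hz : Tendsto z atTop (𝓝 ζ))
    {M : ℝ} (hM : 0 ≤ M)
    (hzM : ∀ᶠ n in atTop, ∀ g ∈ G, confDeriv g (z n) ≤ M * confDeriv g ζ)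
    (f : C(ClosedUnitBall N, ℝ)) :
    Tendsto (fun n => ∑' g : G, confDeriv g.1 (z n) ^ s * f (g.1 (z n))) atTop
      (𝓝 (∑' g : G, confDeriv g.1 ζ ^ s * f (g.1 ζ))) := by
  refine tendsto_tsum_of_dominated_convergence
    (bound := fun g : G => M ^ s * confDeriv g.1 ζ ^ s * ‖f‖)
    ((hζ.mul_left (M ^ s)).mul_right ‖f‖) (fun g => ?_) ?_
  · exact ((((continuous_confDeriv (hG g.2)).tendsto ζ).comp hz).rpow_const (Or.inr hs)).mul
      (((f.continuous.comp g.1.continuous).tendsto ζ).comp hz)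
  · filter_upwards [hzM] with n hn g
    have deriv_nonneg := (confDeriv_pos (hG g.2) (z n)).le
    rw [norm_mul, Real.norm_of_nonneg (Real.rpow_nonneg deriv_nonneg s),
      ← Real.mul_rpow hM (confDeriv_pos (hG g.2) ζ).le]
    exact mul_le_mul (Real.rpow_le_rpow deriv_nonneg (hn g g.2) hs) (f.norm_coe_le_norm _)
      (norm_nonneg _) (Real.rpow_nonneg (deriv_nonneg.trans (hn g g.2)) s)

theorem IsEndingSequence.tendsto_integral_orbitMeasure (hG : G ≤ confGroup N) (hs : 0 ≤ s)
    (hζ : PoincareConverges G ζ s) {w : ClosedUnitBall N} (hw : w ∈ hypBall N)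
    {z : ℕ → ClosedUnitBall N} (hz : IsEndingSequence G w ζ z) (f : C(ClosedUnitBall N, ℝ)) :
    Tendsto (fun n => ∫ x, f x ∂orbitMeasure G s (z n)) atTop
      (𝓝 (∫ x, f x ∂orbitMeasure G s ζ)) := by
  obtain ⟨M, hM, hzM⟩ := hz.exists_eventually_confDeriv_le hG hw
  have tendsto_sum := tendsto_tsum_confDeriv_rpow_mul hG hs hζ hz.2.2 hM hzM
  have tendsto_series : Tendsto (fun n => ∑' g : G, confDeriv g.1 (z n) ^ s) atTop
      (𝓝 (∑' g : G, confDeriv g.1 ζ ^ s)) := by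
    simpa only [ContinuousMap.one_apply, mul_one] using tendsto_sum 1
  simp only [integral_orbitMeasure hG (hζ.of_mem_hypBall hG hs (hz.1 _).1),
    integral_orbitMeasure hG hζ]
  exact (tendsto_series.inv₀ (tsum_confDeriv_rpow_ne_zero hG hζ)).mul (tendsto_sum f)

theorem IsGeodesicRay.isEndingSequence {γ : ℝ → ClosedUnitBall N} {w : ClosedUnitBall N}
    (hγ : IsGeodesicRay γ ζ) (hγ_domain : ∀ t, 0 ≤ t → γ t ∈ dirichletDomain G w) :
    IsEndingSequence G w ζ fun n => γ n :=
  ⟨fun n => hγ_domain n n.cast_nonneg,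
    ⟨γ, hγ, hγ_domain, 0, fun n => ⟨n, n.cast_nonneg, by
      rw [hγ.2.1 n n n.cast_nonneg n.cast_nonneg, sub_self, abs_zero]⟩⟩,
    hγ.2.2.2.comp tendsto_natCast_atTop_atTop⟩

theorem isEndingMeasure_iff_eq_orbitMeasure (hG : G ≤ confGroup N) (hs : 0 ≤ s)
    (hζ : ζ ∈ jorgensenSet G) (hζ_conv : PoincareConverges G ζ s)
    {μ : Measure (ClosedUnitBall N)} : IsEndingMeasure G s ζ μ ↔ μ = orbitMeasure G s ζ := by
  have orbitMeasure_prob := isProbabilityMeasure_orbitMeasure hG hζ_conv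
  constructor
  · rintro ⟨-, μ_prob, w, z, hw, hz, k, hk, hμ⟩
    refine ext_of_forall_integral_eq_of_IsFiniteMeasure fun f => ?_
    exact tendsto_nhds_unique (hμ f.toContinuousMap)
      ((hz.tendsto_integral_orbitMeasure hG hs hζ_conv hw.1 f.toContinuousMap).comp
        hk.tendsto_atTop)
  · rintro rfl
    obtain ⟨-, w, hw, γ, hγ, hγ_domain⟩ := hζ
    have hz := hγ.isEndingSequence hγ_domain
    exact ⟨fun _ => hζ_conv.of_mem_hypBall hG hs, orbitMeasure_prob, w, _, hw, hz, id,
      strictMono_id, hz.tendsto_integral_orbitMeasure hG hs hζ_conv hw.1⟩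

theorem orbitMeasure_image (hG : G ≤ confGroup N) {g : ClosedUnitBall N ≃ₜ ClosedUnitBall N}
    (hg : g ∈ G) {A : Set (ClosedUnitBall N)} (hA : MeasurableSet A) :
    orbitMeasure G s z (g '' A) =
      ∫⁻ x in A, ENNReal.ofReal (confDeriv g x ^ s) ∂orbitMeasure G s z := by
  rw [← lintegral_indicator hA, lintegral_orbitMeasure,
    orbitMeasure_apply (g.measurableEmbedding.measurableSet_image.2 hA),
    ← (Equiv.mulLeft (⟨g, hg⟩ : G)).tsum_eq]
  refine congrArg _ (tsum_congr fun h => ?_)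
  change ENNReal.ofReal (confDeriv (g * h.1) z ^ s) * (g '' A).indicator 1 (g (h.1 z)) = _
  have hg_deriv := (confDeriv_pos (hG hg) (h.1 z)).le
  rw [confDeriv_mul (hG hg) (hG h.2), Real.mul_rpow hg_deriv (confDeriv_pos (hG h.2) z).le,
    ENNReal.ofReal_mul (Real.rpow_nonneg hg_deriv s)]
  by_cases hx : h.1 z ∈ A
  · rw [Set.indicator_of_mem (Set.mem_image_of_mem g hx), Set.indicator_of_mem hx, Pi.one_apply,
      mul_one, mul_comm]
  · rw [Set.indicator_of_notMem (by rwa [g.injective.mem_set_image]), Set.indicator_of_notMem hx,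
      mul_zero, mul_zero]

theorem isConformalMeasure_orbitMeasure (hG : G ≤ confGroup N) (h : PoincareConverges G z s) :
    IsConformalMeasure G s (orbitMeasure G s z) :=
  ⟨isProbabilityMeasure_orbitMeasure hG h, fun _ hg _ hA => orbitMeasure_image hG hg hA⟩

theorem countable_groupOrbit (hG : G ≤ confGroup N) (h : PoincareConverges G z s) :
    (groupOrbit G z).Countable := by
  have support_eq : Function.support (fun g : G => confDeriv g.1 z ^ s) = Set.univ :=
    Set.eq_univ_of_forall fun g => (Real.rpow_pos_of_pos (confDeriv_pos (hG g.2) z) s).ne'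
  have : Countable G := Set.countable_univ_iff.1 (support_eq ▸ h.countable_support)
  refine (Set.countable_range fun g : G => g.1 z).mono ?_
  rintro _ ⟨g, hg, rfl⟩
  exact ⟨⟨g, hg⟩, rfl⟩

theorem orbitMeasure_compl_groupOrbit (hG : G ≤ confGroup N) (h : PoincareConverges G z s) :
    orbitMeasure G s z (groupOrbit G z)ᶜ = 0 := by
  rw [orbitMeasure_apply (countable_groupOrbit hG h).measurableSet.compl]
  refine mul_eq_zero_of_right _ (ENNReal.tsum_eq_zero.2 fun g => ?_)
  have g_mem : g.1 z ∈ groupOrbit G z := ⟨g.1, g.2, rfl⟩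
  rw [Set.indicator_of_notMem (Set.notMem_compl_iff.2 g_mem), mul_zero]

theorem orbitMeasure_singleton_pos (hG : G ≤ confGroup N) (h : PoincareConverges G z s)
    {x : ClosedUnitBall N} (hx : x ∈ groupOrbit G z) : 0 < orbitMeasure G s z {x} := by
  obtain ⟨g, hg, rfl⟩ := hx
  rw [orbitMeasure_apply (measurableSet_singleton _)]
  refine ENNReal.mul_pos (ENNReal.inv_ne_zero.2 ((poincareSeries_ne_top_iff hG).2 h)) ?_
  refine (lt_of_lt_of_le ?_ (ENNReal.le_tsum (⟨g, hg⟩ : G))).ne'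
  rw [Set.indicator_of_mem (Set.mem_singleton _), Pi.one_apply, mul_one]
  exact ENNReal.ofReal_pos.2 (Real.rpow_pos_of_pos (confDeriv_pos (hG hg) z) s)

theorem isPurelyAtomic_of_measure_compl_eq_zero {X : Type*} [MeasurableSpace X] {μ : Measure X}
    {O : Set X} (h_compl : μ Oᶜ = 0) (h_pos : ∀ x ∈ O, 0 < μ {x}) : IsPurelyAtomic μ := by
  intro A _ hA
  obtain ⟨x, hxA, hxO⟩ : (A ∩ O).Nonempty := Set.not_disjoint_iff_nonempty_inter.1 fun h =>
    hA.ne' (measure_mono_null h.subset_compl_right h_compl)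
  exact ⟨x, hxA, h_pos x hxO⟩

end OrbitMeasure

theorem tsum_ofReal_two_div_sub_one_rpow_lt {φ : ℕ → ℝ} {s : ℝ} (hs : 0 ≤ s)
    (hφ : ∀ n, 2 ≤ φ n) (hφ_summable : Summable fun n => (4 / φ n) ^ (2 * s))
    (hφ_sum : ∑' n, (4 / φ n) ^ (2 * s) < 1 / 2) :
    ∑' n, ENNReal.ofReal ((2 / (φ n - 1)) ^ (2 * s)) < 2⁻¹ := by
  have two_div_le (n : ℕ) : 2 / (φ n - 1) ≤ 4 / φ n := by
    rw [div_le_div_iff₀ (by linarith [hφ n]) (by linarith [hφ n])]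
    linarith [hφ n]
  have two_div_nonneg (n : ℕ) : 0 ≤ 2 / (φ n - 1) :=
    div_nonneg zero_le_two (by linarith [hφ n])
  calc ∑' n, ENNReal.ofReal ((2 / (φ n - 1)) ^ (2 * s))
      ≤ ∑' n, ENNReal.ofReal ((4 / φ n) ^ (2 * s)) := ENNReal.tsum_le_tsum fun n =>
        ENNReal.ofReal_le_ofReal
          (Real.rpow_le_rpow (two_div_nonneg n) (two_div_le n) (by positivity))
    _ = ENNReal.ofReal (∑' n, (4 / φ n) ^ (2 * s)) :=
        (ENNReal.ofReal_tsum_of_nonneg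
          (fun n => Real.rpow_nonneg ((two_div_nonneg n).trans (two_div_le n)) _) hφ_summable).symm
    _ < ENNReal.ofReal (1 / 2) := (ENNReal.ofReal_lt_ofReal_iff (by norm_num)).2 hφ_sum
    _ = 2⁻¹ := by rw [one_div, ENNReal.ofReal_inv_of_pos two_pos, ENNReal.ofReal_ofNat]

theorem mainTheorem10_general {N : ℕ} (hN : 1 ≤ N) {s : ℝ} (hs : 0 ≤ s) {φ : ℕ → ℝ}
    (hφ : ∀ n, 1 < φ n) (hφ_sum : ∑' n, ENNReal.ofReal ((2 / (φ n - 1)) ^ (2 * s)) < 2⁻¹)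
    (S : SchottkyData N φ) {ζ : ClosedUnitBall N} (hζ : ζ ∈ S.jorgensenSet') :
    PoincareConverges S.group ζ s ∧
    (∃ μ, IsEndingMeasure S.group s ζ μ) ∧
    ∀ μ, IsEndingMeasure S.group s ζ μ →
      IsConformalMeasure S.group s μ ∧ IsPurelyAtomic μ ∧
      μ (groupOrbit S.group ζ)ᶜ = 0 ∧ ∀ x ∈ groupOrbit S.group ζ, 0 < μ {x} := by
  have hζ_ext : ∀ n ε, ζ ∈ bdExt (S.centre n ε) (φ n * S.radius n) := by
    simpa only [Set.mem_iInter] using hζ.2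
  have hζ_conv : PoincareConverges S.group ζ s :=
    S.poincareConverges_group hN hs hφ hφ_sum (hζ_ext 0 true).1 fun n ε => (hζ_ext n ε).2.le
  simp only [isEndingMeasure_iff_eq_orbitMeasure S.group_le hs hζ.1 hζ_conv, exists_eq, true_and,
    forall_eq]
  have compl_eq_zero := orbitMeasure_compl_groupOrbit S.group_le hζ_conv
  have singleton_pos (x) (hx : x ∈ groupOrbit S.group ζ) :=
    orbitMeasure_singleton_pos S.group_le hζ_conv hx
  exact ⟨hζ_conv, isConformalMeasure_orbitMeasure S.group_le hζ_conv,
    isPurelyAtomic_of_measure_compl_eq_zero compl_eq_zero singleton_pos, compl_eq_zero,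
    singleton_pos⟩

theorem mainTheorem10 (N : ℕ) (hN : 1 ≤ N) (s : ℝ) (hs : 0 < s) (φ : ℕ → ℝ)
    (hφ_two : ∀ n, 2 ≤ φ n) (hφ_mono : Monotone φ)
    (hφ_summable : Summable fun n => (4 / φ n) ^ (2 * s))
    (hφ_sum : ∑' n, (4 / φ n) ^ (2 * s) < 1 / 2)
    (S : SchottkyData N φ) (ζ : ClosedUnitBall N) (hζ : ζ ∈ S.jorgensenSet') :
    PoincareConverges S.group ζ s ∧
    (∃ μ, IsEndingMeasure S.group s ζ μ) ∧
    ∀ μ, IsEndingMeasure S.group s ζ μ →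
      IsConformalMeasure S.group s μ ∧ IsPurelyAtomic μ ∧
      μ (groupOrbit S.group ζ)ᶜ = 0 ∧ ∀ x ∈ groupOrbit S.group ζ, 0 < μ {x} :=
  mainTheorem10_general hN hs.le (fun n => one_lt_two.trans_le (hφ_two n))
    (tsum_ofReal_two_div_sub_one_rpow_lt hs.le hφ_two hφ_summable hφ_sum) S hζ
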